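/- Let $n\ge 2$, let $\mathcal G$ be a finite-dimensional simple complex Lie algebra with a nondegenerate symmetric invariant bilinear form $(\,,)$ and a Cartan subalgebra $h$, and let $A=A_n=\mathbb C[t_1^{\pm1},\dots,t_n^{\pm1}]$. Let $Z=\Omega_A/d_A$ be the complex vector space spanned by the symbols $t^{m}K_i$ ($m\in\mathbb Z^n$, $1\le i\le n$) with the relations $\sum_i m_i t^{m}K_i=0$, and let $D=\bigoplus_{i=1}^n\mathbb C d_i$. The toroidal Lie algebra is $\tau=\mathcal G\otimes A\oplus Z\oplus D$, where, with $X(r)=X\otimes t^r$, $d(t^r)t^s=\sum_i r_i t^{r+s}K_i$ and $K_i=t^0K_i$, the bracket is $$[X(r),Y(s)]=[X,Y](r+s)+(X,Y)\,d(t^r)t^s,\quad [Z,\mathcal G\otimes A\oplus Z]=0,$$ $$[d_i,X(r)]=r_iX(r),\quad [d_i,t^mK_j]=m_it^mK_j,\quad [d_i,d_j]=0 .$$ Let $\tilde h=h\oplus\bigoplus_i\mathbb C K_i\oplus\bigoplus_i\mathbb C d_i$. For $B\in GL(n,\mathbb Z)$ let $B$ also denote the automorphism of $\tau$ with $X(r)\mapsto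 X(Br)$, $d(t^r)t^s\mapsto d(t^{Br})t^{Bs}$, $d_i\mapsto\sum_j (B^{-1})_{ij}d_j$; for a $\tau$-module $V$, let $V^B$ be the twisted module, on which $y\in\tau$ acts as $B(y)$ acts on $V$. Let $\mathcal G_{\rm aff}=\mathcal G\otimes\mathbb C[t_n^{\pm1}]\oplus\mathbb C K_n$ with $[X\otimes t_n^a,Y\otimes t_n^b]=[X,Y]\otimes t_n^{a+b}+a\,\delta_{a+b,0}(X,Y)K_n$ and $K_n$ central, let $A_{n-1}=\mathbb C[t_1^{\pm1},\dots,t_{n-1}^{\pm1}]$, and form the Lie algebra $\mathcal G_{\rm aff}\otimes A_{n-1}\oplus D$, in which $D$ is abelian, $d_1,\dots,d_{n-1}$ act on $A_{n-1}$ as $t_i\partial/\partial t_i$, and $d_n$ acts on $\mathcal G_{\rm aff}$ as $t_n\,d/dt_n$. Let $\varphi:\tau\to\mathcal G_{\rm aff}\otimes A_{n-1}\oplus D$ be the Lie algebra homomorphism with $X(r)\mapsto(X\otimes t_n^{r_n})\otimes t_1^{r_1}\cdots t_{n-1}^{r_{n-1}}$, $d_i\mapsto d_i$, $t^mK_i\mapsto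 0$ if $i\le n-1$ or $m_n\ne0$, and $t^mK_n\mapsto K_n\otimes t_1^{m_1}\cdots t_{n-1}^{m_{n-1}}$ if $m_n=0$. **Theorem.** Let $V$ be an irreducible $\tau$-module which is a weight module for $\tilde h$ (that is, the sum of its weight spaces) with finite-dimensional weight spaces. 1. If some element of $Z$ acts on $V$ as a non-zero operator, then the subgroup of $\mathbb Z^n$ generated by all $m$ for which $t^mK_i$ acts as a non-zero operator on $V$ for some $i$ has rank exactly $n-1$. 2. (Without assuming that some element of $Z$ acts as a non-zero operator.) There is $B\in GL(n,\mathbb Z)$ such that on $V^B$ the operators $t^mK_i$ are zero whenever $1\le i\le n-1$ or $m_n\neq0$, and such that $V$ carries a module structure over $\mathcal G_{\rm aff}\otimes A_{n-1}\oplus D$ whose pullback along $\varphi$ is $V^B$. -/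

import Mathlib

open scoped TensorProduct

noncomputable section

set_option linter.unusedSimpArgs false
set_option linter.unusedSectionVars false

namespace Toroidal

/-- A nondegenerate symmetric invariant bilinear form on a complex Lie algebra. -/
structure InvariantForm (𝔤 : Type*) [LieRing 𝔤] [LieAlgebra ℂ 𝔤] where
  form : LinearMap.BilinForm ℂ 𝔤
  symm : form.IsSymm
  nondegenerate : form.Nondegenerate
  invariant : form.lieInvariant 𝔤

section Loop

/-! Generalities on `L ⊗ ℂ[M]`, where `M` is a group of exponents such as `ℤⁿ`. -/

variable {L : Type*} [LieRing L] [LieAlgebra ℂ L] {M : Type*} [AddCommGroup M]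
  {P : Type*} [AddCommGroup P] [Module ℂ P]

/-- The Lie algebra `L ⊗ ℂ[M]`. -/
def Loop (M L : Type*) [AddCommGroup M] [LieRing L] [LieAlgebra ℂ L] : Type _ :=
  LieAlgebra.loopAlgebra ℂ M L

instance : LieRing (Loop M L) := inferInstanceAs (LieRing (LieAlgebra.loopAlgebra ℂ M L))

instance : LieAlgebra ℂ (Loop M L) :=
  inferInstanceAs (LieAlgebra ℂ (LieAlgebra.loopAlgebra ℂ M L))

/-- `mono r X` is the element `X(r) = X ⊗ t^r`. -/
def mono (r : M) : L →ₗ[ℂ] Loop M L :=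
  TensorProduct.mk ℂ (AddMonoidAlgebra ℂ M) L (AddMonoidAlgebra.single r 1)

lemma loop_hom_ext {f g : Loop M L →ₗ[ℂ] P}
    (h : ∀ r X, f (mono r X) = g (mono r X)) : f = g := by
  refine TensorProduct.ext ?_
  ext r X
  exact h r X

lemma loopAlgebra_mem_closure (x : LieAlgebra.loopAlgebra ℂ M L) :
    x ∈ AddSubmonoid.closure {y : LieAlgebra.loopAlgebra ℂ M L |
      ∃ (r : M) (X : L), y = AddMonoidAlgebra.single r 1 ⊗ₜ[ℂ] X} := by
  induction x using TensorProduct.induction_on with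
  | zero => exact zero_mem _
  | add x y hx hy => exact add_mem hx hy
  | tmul a X =>
    induction a using AddMonoidAlgebra.induction_linear with
    | zero => rw [TensorProduct.zero_tmul]; exact zero_mem _
    | add a b ha hb => rw [TensorProduct.add_tmul]; exact add_mem ha hb
    | single r c =>
      refine AddSubmonoid.subset_closure ⟨r, c • X, ?_⟩
      rw [TensorProduct.tmul_smul, TensorProduct.smul_tmul']
      simp

lemma loop_induction {p : Loop M L → Prop} (h0 : p 0)
    (hadd : ∀ x y, p x → p y → p (x + y)) (hmono : ∀ r X, p (mono r X)) (x : Loop M L) : p x :=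
  AddSubmonoid.closure_induction (motive := fun y _ => p y)
    (fun y hy => by obtain ⟨r, X, rfl⟩ := hy; exact hmono r X) h0 (fun x y _ _ => hadd x y)
    (loopAlgebra_mem_closure x)

@[simp] lemma mono_lie (r s : M) (X Y : L) : ⁅mono r X, mono s Y⁆ = mono (r + s) ⁅X, Y⁆ := by
  refine (LieAlgebra.ExtendScalars.bracket_tmul ..).trans ?_
  rw [AddMonoidAlgebra.single_mul_single, mul_one]
  rfl

/-- The linear map out of `L ⊗ ℂ[M]` with `X(r) ↦ f r X`. -/
def loopLift (f : M → L →ₗ[ℂ] P) : Loop M L →ₗ[ℂ] P :=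
  TensorProduct.lift ((AddMonoidAlgebra.basis M ℂ).constr ℂ f)

@[simp] lemma loopLift_mono (f : M → L →ₗ[ℂ] P) (r : M) (X : L) :
    loopLift f (mono r X) = f r X := by
  refine (TensorProduct.lift.tmul ..).trans ?_
  rw [← AddMonoidAlgebra.basis_apply, Module.Basis.constr_basis]

/-- The derivation `X(r) ↦ χ(r) X(r) + (δ X)(r)` of `L ⊗ ℂ[M]`. -/
def loopDer (χ : M →+ ℂ) (δ : LieDerivation ℂ L L) :
    LieDerivation ℂ (Loop M L) (Loop M L) where
  toLinearMap := loopLift fun r => χ r • mono r + mono r ∘ₗ (δ : L →ₗ[ℂ] L)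
  leibniz' a b := by
    induction a using loop_induction with
    | h0 => simp
    | hadd x y hx hy => simp only [add_lie, lie_add, map_add, hx, hy]; abel
    | hmono r X =>
      induction b using loop_induction with
      | h0 => simp
      | hadd x y hx hy => simp only [add_lie, lie_add, map_add, hx, hy]; abel
      | hmono s Y =>
        have e : ∀ r X, loopLift (fun r : M => χ r • mono r + mono r ∘ₗ (δ : L →ₗ[ℂ] L))
            (mono r X) = χ r • mono r X + mono r (δ X) := fun r X => by simp
        simp only [mono_lie, e, lie_add, lie_smul, LieDerivation.apply_lie_eq_sub, map_add,
          map_sub, add_smul]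
        rw [← lie_skew Y X, add_comm s r, map_neg, smul_neg]
        abel

@[simp] lemma loopDer_mono (χ : M →+ ℂ) (δ : LieDerivation ℂ L L) (r : M) (X : L) :
    loopDer χ δ (mono r X) = χ r • mono r X + mono r (δ X) := by
  change loopLift _ (mono r X) = _
  simp

/-- The bilinear map `(X(r), Y(s)) ↦ (X, Y) β(r, s)`. -/
def pairing (Φ : InvariantForm L) (β : M → M → P) :
    Loop M L →ₗ[ℂ] Loop M L →ₗ[ℂ] P :=
  loopLift fun r => LinearMap.flip (loopLift fun s =>
    LinearMap.flip (Φ.form.compr₂ (LinearMap.toSpanSingleton ℂ P (β r s))))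

@[simp] lemma pairing_mono (Φ : InvariantForm L) (β : M → M → P) (r s : M) (X Y : L) :
    pairing Φ β (mono r X) (mono s Y) = Φ.form X Y • β r s := by
  simp [pairing]

lemma pairing_self (Φ : InvariantForm L) (β : M → M → P) (h₁ : ∀ r s, β s r = -β r s) (x) :
    pairing Φ β x x = 0 := by
  have key : (pairing Φ β) = -(pairing Φ β).flip := by
    refine loop_hom_ext fun r X => loop_hom_ext fun s Y => ?_
    simp [h₁ s r, Φ.symm.eq X Y]
  have := LinearMap.congr_fun₂ key x x
  simp only [LinearMap.neg_apply, LinearMap.flip_apply] at this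
  have h2 : (2 : ℂ) • pairing Φ β x x = 0 := by
    rw [two_smul]; nth_rw 1 [this]; simp
  exact (smul_eq_zero.mp h2).resolve_left two_ne_zero

lemma pairing_jacobi (Φ : InvariantForm L) (β : M → M → P) (h₁ : ∀ r s, β s r = -β r s)
    (h₂ : ∀ r s u, β (r + s) u + β (s + u) r + β (u + r) s = 0) (x y z) :
    pairing Φ β x ⁅y, z⁆ = pairing Φ β ⁅x, y⁆ z + pairing Φ β y ⁅x, z⁆ := by
  induction x using loop_induction with
  | h0 => simp
  | hadd x x' hx hx' => simp only [add_lie, lie_add, map_add, LinearMap.add_apply, hx, hx']; abel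
  | hmono r X =>
    induction y using loop_induction with
    | h0 => simp
    | hadd x x' hx hx' => simp only [add_lie, lie_add, map_add, LinearMap.add_apply, hx, hx']; abel
    | hmono s Y =>
      induction z using loop_induction with
      | h0 => simp
      | hadd x x' hx hx' =>
        simp only [lie_add, map_add, hx, hx']; abel
      | hmono u Z =>
        have e₁ : Φ.form Y ⁅X, Z⁆ = -Φ.form ⁅X, Y⁆ Z := by rw [Φ.invariant X Y Z, neg_neg]
        have e₂ : Φ.form X ⁅Y, Z⁆ = Φ.form ⁅X, Y⁆ Z := by
          rw [← lie_skew X Y, map_neg, LinearMap.neg_apply, Φ.invariant Y X Z, neg_neg]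
        have e₃ := h₂ r s u
        rw [h₁ r (s + u), h₁ s (u + r), add_comm u r] at e₃
        have e₄ : β r (s + u) = β (r + s) u - β s (r + u) := by
          rw [← sub_eq_zero, ← neg_eq_zero, ← e₃]; abel
        rw [mono_lie, mono_lie, mono_lie, pairing_mono, pairing_mono, pairing_mono, e₁, e₂, e₄,
          smul_sub, neg_smul, sub_eq_add_neg]

/-- Data for a central extension of `L ⊗ ℂ[M]` by `P`: an invariant form on `L` and a map `β` such
that `(X(r), Y(s)) ↦ (X, Y) β(r, s)` is a 2-cocycle. -/
structure CentralData (L : Type*) [LieRing L] [LieAlgebra ℂ L] (M : Type*) [AddCommGroup M]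
    (P : Type*) [AddCommGroup P] [Module ℂ P] where
  Φ : InvariantForm L
  β : M → M → P
  skew : ∀ r s, β s r = -β r s
  cyclic : ∀ r s u, β (r + s) u + β (s + u) r + β (u + r) s = 0

/-- The 2-cocycle `(X(r), Y(s)) ↦ (X, Y) β(r, s)`. -/
def cocycle (c : CentralData L M P) :
    LieModule.Cohomology.twoCocycle ℂ (Loop M L) (TrivialLieModule ℂ (Loop M L) P) :=
  ⟨⟨(pairing c.Φ c.β).compr₂ (TrivialLieModule.equiv ℂ (Loop M L) P).symm,
      fun x => pairing_self c.Φ c.β c.skew x⟩,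
    (LieModule.Cohomology.mem_twoCocycle_iff_of_trivial ..).mpr
      (pairing_jacobi c.Φ c.β c.skew c.cyclic)⟩

/-- The central extension `L ⊗ ℂ[M] ⊕ P` with
`[X(r), Y(s)] = [X, Y](r + s) + (X, Y) β(r, s)` and `P` central. -/
abbrev CentralExt (c : CentralData L M P) : Type _ := LieAlgebra.ofTwoCocycle (cocycle c)

/-- The element `x + p` of the central extension. -/
def CentralData.pair (c : CentralData L M P) : (Loop M L × P) ≃ₗ[ℂ] CentralExt c where
  toFun x := ⟨x⟩
  invFun x := x.carrier
  map_add' _ _ := rfl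
  map_smul' _ _ := rfl

@[simp] lemma pair_zero_zero (c : CentralData L M P) : c.pair (0, 0) = 0 := map_zero c.pair

lemma pair_lie (c : CentralData L M P) (x y : Loop M L × P) :
    ⁅c.pair x, c.pair y⁆ = c.pair (⁅x.1, y.1⁆, pairing c.Φ c.β x.1 y.1) := by
  refine congrArg c.pair (Prod.ext rfl ?_)
  change pairing c.Φ c.β x.1 y.1 + 0 - 0 = _
  simp

/-- The derivation of the central extension acting by `X(r) ↦ χ(r) X(r)` on the first summand
and by `η` on the central summand. -/
def extDer (c : CentralData L M P) (χ : M →+ ℂ) (η : P →ₗ[ℂ] P)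
    (hη : ∀ r s, η (c.β r s) = (χ r + χ s) • c.β r s) :
    LieDerivation ℂ (CentralExt c) (CentralExt c) where
  toLinearMap := c.pair.toLinearMap ∘ₗ
    ((loopDer (L := L) χ 0).toLinearMap.prodMap η) ∘ₗ c.pair.symm.toLinearMap
  leibniz' a b := by
    obtain ⟨⟨a, p⟩, rfl⟩ := c.pair.surjective a
    obtain ⟨⟨b, q⟩, rfl⟩ := c.pair.surjective b
    simp only [pair_lie, LinearMap.comp_apply, LinearEquiv.coe_coe,
      LinearEquiv.symm_apply_apply, LinearMap.prodMap_apply]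
    rw [← map_sub]
    refine congrArg c.pair (Prod.ext (LieDerivation.leibniz' _ a b) ?_)
    change η (pairing c.Φ c.β a b) =
      pairing c.Φ c.β a (loopDer χ 0 b) - pairing c.Φ c.β b (loopDer χ 0 a)
    induction a using loop_induction with
    | h0 => simp
    | hadd x x' hx hx' => simp only [map_add, LinearMap.add_apply, hx, hx']; abel
    | hmono r X =>
      induction b using loop_induction with
      | h0 => simp
      | hadd x x' hx hx' => simp only [map_add, LinearMap.add_apply, hx, hx']; abel
      | hmono s Y =>
        have e : c.Φ.form Y X = c.Φ.form X Y := c.Φ.symm.eq Y X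
        simp only [loopDer_mono, LieDerivation.zero_apply, map_zero, add_zero, map_smul,
          pairing_mono, hη, c.skew r s, e]
        module

@[simp] lemma extDer_pair (c : CentralData L M P) (χ : M →+ ℂ) (η : P →ₗ[ℂ] P)
    (hη : ∀ r s, η (c.β r s) = (χ r + χ s) • c.β r s) (x : Loop M L × P) :
    extDer c χ η hη (c.pair x) = c.pair (loopDer χ 0 x.1, η x.2) := rfl

/-- The homomorphism out of a central extension with `X(r) ↦ F r X` and `p ↦ η p`. -/
def extLift {K : Type*} [LieRing K] [LieAlgebra ℂ K] (c : CentralData L M P)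
    (F : M → L →ₗ[ℂ] K) (η : P →ₗ[ℂ] K)
    (hF : ∀ r s X Y, ⁅F r X, F s Y⁆ = F (r + s) ⁅X, Y⁆ + c.Φ.form X Y • η (c.β r s))
    (hη : ∀ p r X, ⁅η p, F r X⁆ = 0) (hηη : ∀ p q, ⁅η p, η q⁆ = 0) :
    CentralExt c →ₗ⁅ℂ⁆ K where
  toLinearMap := (loopLift F).coprod η ∘ₗ c.pair.symm.toLinearMap
  map_lie' := by
    intro a b
    obtain ⟨⟨a, p⟩, rfl⟩ := c.pair.surjective a
    obtain ⟨⟨b, q⟩, rfl⟩ := c.pair.surjective b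
    have h₁ : ∀ p (b : Loop M L), ⁅η p, loopLift F b⁆ = 0 := by
      intro p b
      induction b using loop_induction with
      | h0 => simp
      | hadd x y hx hy => simp [hx, hy]
      | hmono r X => simp [hη]
    have h₂ : ∀ (b : Loop M L) p, ⁅loopLift F b, η p⁆ = 0 := by
      intro b p
      rw [← lie_skew, h₁, neg_zero]
    have h₃ : ∀ a b : Loop M L, ⁅loopLift F a, loopLift F b⁆ =
        loopLift F ⁅a, b⁆ + η (pairing c.Φ c.β a b) := by
      intro a b
      induction a using loop_induction with
      | h0 => simp
      | hadd x x' hx hx' => simp only [add_lie, map_add, LinearMap.add_apply, hx, hx']; abel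
      | hmono r X =>
        induction b using loop_induction with
        | h0 => simp
        | hadd x x' hx hx' => simp only [lie_add, map_add, hx, hx']; abel
        | hmono s Y => simp [hF]
    change ((loopLift F).coprod η) (c.pair.symm ⁅c.pair (a, p), c.pair (b, q)⁆) =
      ⁅loopLift F a + η p, loopLift F b + η q⁆
    rw [pair_lie, LinearEquiv.symm_apply_apply, LinearMap.coprod_apply, add_lie, lie_add, lie_add,
      h₁, h₂, hηη, h₃]
    simp

lemma extLift_pair {K : Type*} [LieRing K] [LieAlgebra ℂ K] (c : CentralData L M P)
    (F : M → L →ₗ[ℂ] K) (η : P →ₗ[ℂ] K) (hF hη hηη) (x : Loop M L × P) :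
    extLift c F η hF hη hηη (c.pair x) = loopLift F x.1 + η x.2 := rfl

lemma ext_induction (c : CentralData L M P) {p : CentralExt c → Prop}
    (hadd : ∀ x y, p x → p y → p (x + y)) (hmono : ∀ r X, p (c.pair (mono r X, 0)))
    (hcentral : ∀ q, p (c.pair (0, q))) (x : CentralExt c) : p x := by
  obtain ⟨⟨a, q⟩, rfl⟩ := c.pair.surjective x
  have : (a, q) = (a, 0) + ((0 : Loop M L), q) := by simp
  rw [this, map_add]
  refine hadd _ _ ?_ (hcentral q)
  induction a using loop_induction with
  | h0 => exact hcentral 0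
  | hadd x y hx hy =>
    have : (x + y, (0 : P)) = (x, 0) + (y, 0) := by simp
    rw [this, map_add]
    exact hadd _ _ (hx (by simp)) (hy (by simp))
  | hmono r X => exact hmono r X

end Loop

/-- The homomorphism of semidirect sums induced by a pair of compatible homomorphisms. -/
def semiMap {K K' D D' : Type*} [LieRing K] [LieAlgebra ℂ K] [LieRing K'] [LieAlgebra ℂ K']
    [LieRing D] [LieAlgebra ℂ D] [LieRing D'] [LieAlgebra ℂ D']
    {ψ : D →ₗ⁅ℂ⁆ LieDerivation ℂ K K} {ψ' : D' →ₗ⁅ℂ⁆ LieDerivation ℂ K' K'}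
    (f : K →ₗ⁅ℂ⁆ K') (g : D →ₗ⁅ℂ⁆ D') (h : ∀ d x, f (ψ d x) = ψ' (g d) (f x)) :
    LieAlgebra.SemiDirectSum K D ψ →ₗ⁅ℂ⁆ LieAlgebra.SemiDirectSum K' D' ψ' where
  toFun x := ⟨f x.left, g x.right⟩
  map_add' x y := by simp
  map_smul' t x := by simp
  map_lie' := by intro x y; simp [h]

/-! ### The toroidal Lie algebra -/

/-- `Ω_A / d_A` for `A = ℂ[t₁^±¹, …, tₙ^±¹]`: the space spanned by the `t^m K_i` subject to the
relations `∑ i, m_i t^m K_i = 0`. -/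
abbrev Omega (n : ℕ) : Type :=
  ((Fin n → ℤ) →₀ (Fin n → ℂ)) ⧸
    Submodule.span ℂ (Set.range fun m : Fin n → ℤ => Finsupp.single m fun i => (m i : ℂ))

/-- The abelian Lie algebra `D = ⨁ ℂ d_i`; the function `c` stands for `∑ i, c_i d_i`. -/
def Degrees (n : ℕ) : Type := Fin n → ℂ

instance (n : ℕ) : AddCommGroup (Degrees n) := inferInstanceAs (AddCommGroup (Fin n → ℂ))

instance (n : ℕ) : LieRing (Degrees n) where
  bracket _ _ := 0
  add_lie := by simp
  lie_add := by simp
  lie_self := by simp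
  leibniz_lie := by simp

instance (n : ℕ) : Module ℂ (Degrees n) := inferInstanceAs (Module ℂ (Fin n → ℂ))

instance (n : ℕ) : LieAlgebra ℂ (Degrees n) where
  lie_smul a _ _ := (smul_zero a).symm

/-- The basis element `d_i` of `D`. -/
def Degrees.basis {n : ℕ} (i : Fin n) : Degrees n := (Pi.single i 1 : Fin n → ℂ)

lemma Degrees.lie_eq_zero {n : ℕ} (c c' : Degrees n) : ⁅c, c'⁆ = 0 := rfl

/-- `omega m v = ∑ i, v_i t^m K_i`. -/
def omega {n : ℕ} (m : Fin n → ℤ) : (Fin n → ℂ) →ₗ[ℂ] Omega n :=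
  Submodule.mkQ _ ∘ₗ Finsupp.lsingle m

lemma omega_self {n : ℕ} (m : Fin n → ℤ) : omega m (fun i => (m i : ℂ)) = 0 :=
  (Submodule.Quotient.mk_eq_zero _).mpr (Submodule.subset_span ⟨m, rfl⟩)

/-- The linear map out of `Ω_A / d_A` with `∑ i, v_i t^m K_i ↦ f m v`. -/
def omegaLift {n : ℕ} {Q : Type*} [AddCommGroup Q] [Module ℂ Q]
    (f : (Fin n → ℤ) → (Fin n → ℂ) →ₗ[ℂ] Q) (hf : ∀ m, f m (fun i => (m i : ℂ)) = 0) :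
    Omega n →ₗ[ℂ] Q :=
  Submodule.liftQ _ (Finsupp.lsum ℂ f) <| by
    rw [Submodule.span_le]
    rintro _ ⟨m, rfl⟩
    simp [hf]

@[simp] lemma omegaLift_omega {n : ℕ} {Q : Type*} [AddCommGroup Q] [Module ℂ Q]
    (f : (Fin n → ℤ) → (Fin n → ℂ) →ₗ[ℂ] Q) (hf) (m : Fin n → ℤ) (v : Fin n → ℂ) :
    omegaLift f hf (omega m v) = f m v := by
  refine (Submodule.liftQ_apply ..).trans ?_
  simp

lemma omega_hom_ext {n : ℕ} {Q : Type*} [AddCommGroup Q] [Module ℂ Q]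
    {f g : Omega n →ₗ[ℂ] Q} (h : ∀ m v, f (omega m v) = g (omega m v)) : f = g := by
  refine Submodule.linearMap_qext _ (Finsupp.lhom_ext' fun m => LinearMap.ext fun v => h m v)

/-- The eigenvalue `∑ i, c_i r_i` of the degree derivation `∑ i, c_i d_i` in degree `r`. -/
def weight {n : ℕ} : Degrees n →ₗ[ℂ] (Fin n → ℤ) →+ ℂ where
  toFun c :=
    { toFun r := ∑ i, c i * (r i : ℂ)
      map_zero' := by simp
      map_add' r s := by simp [mul_add, Finset.sum_add_distrib] }
  map_add' c c' := by
    refine DFunLike.ext _ _ fun r => ?_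
    change ∑ i, (c i + c' i) * (r i : ℂ) = ∑ i, c i * (r i : ℂ) + ∑ i, c' i * (r i : ℂ)
    simp [add_mul, Finset.sum_add_distrib]
  map_smul' a c := by
    refine DFunLike.ext _ _ fun r => ?_
    change ∑ i, (a * c i) * (r i : ℂ) = a * ∑ i, c i * (r i : ℂ)
    simp [mul_assoc, Finset.mul_sum]

lemma weight_apply {n : ℕ} (c : Degrees n) (r : Fin n → ℤ) :
    weight c r = ∑ i, c i * (r i : ℂ) := rfl

variable {𝔤 : Type*} [LieRing 𝔤] [LieAlgebra ℂ 𝔤] (Φ : InvariantForm 𝔤) (n : ℕ)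

/-- The cocycle data `β(r, s) = d(t^r) t^s = ∑ i, r_i t^(r+s) K_i`. -/
def toroidalData : CentralData 𝔤 (Fin n → ℤ) (Omega n) where
  Φ := Φ
  β r s := omega (r + s) fun i => (r i : ℂ)
  skew r s := by
    rw [eq_neg_iff_add_eq_zero, add_comm s r, ← map_add]
    convert omega_self (r + s)
    simp [add_comm]
  cyclic r s u := by
    rw [show s + u + r = r + s + u by abel, show u + r + s = r + s + u by abel, ← map_add,
      ← map_add]
    convert congrArg ((2 : ℂ) • ·) (omega_self (r + s + u)) using 1
    · rw [← map_smul]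
      congr 1
      ext i
      simp
      ring
    · simp

/-- `𝔤 ⊗ A ⊕ Ω_A / d_A`. -/
abbrev ToroidalCore : Type _ := CentralExt (toroidalData Φ n)

/-- The derivation `∑ i, c_i d_i` of `𝔤 ⊗ A ⊕ Ω_A / d_A`, which multiplies `X(r)` by
`∑ i, c_i r_i` and `t^m K_j` by `∑ i, c_i m_i`. -/
def coreDer (c : Degrees n) : LieDerivation ℂ (ToroidalCore Φ n) (ToroidalCore Φ n) :=
  extDer (toroidalData Φ n) (weight c)
    (omegaLift (fun m => weight c m • omega m) fun m => by simp [omega_self])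
    fun r s => by
      change omegaLift _ _ (omega _ _) = _ • omega _ _
      simp

lemma coreDer_mono (c : Degrees n) (r : Fin n → ℤ) (X : 𝔤) :
    coreDer Φ n c ((toroidalData Φ n).pair (mono r X, 0)) =
      weight c r • (toroidalData Φ n).pair (mono r X, 0) := by
  refine (extDer_pair ..).trans ?_
  rw [← map_smul]
  simp

lemma coreDer_omega (c : Degrees n) (m : Fin n → ℤ) (v : Fin n → ℂ) :
    coreDer Φ n c ((toroidalData Φ n).pair (0, omega m v)) =
      weight c m • (toroidalData Φ n).pair (0, omega m v) := by
  refine (extDer_pair ..).trans ?_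
  rw [← map_smul]
  simp

lemma omega_induction {n : ℕ} {p : Omega n → Prop} (hadd : ∀ x y, p x → p y → p (x + y))
    (h : ∀ m v, p (omega m v)) (x : Omega n) : p x := by
  obtain ⟨x, rfl⟩ := Submodule.mkQ_surjective _ x
  induction x using Finsupp.induction_linear with
  | zero => simpa using h 0 0
  | add x y hx hy => rw [map_add]; exact hadd _ _ hx hy
  | single m v => exact h m v

lemma core_induction {p : ToroidalCore Φ n → Prop}
    (hadd : ∀ x y, p x → p y → p (x + y))
    (hmono : ∀ r X, p ((toroidalData Φ n).pair (mono r X, 0)))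
    (homega : ∀ m v, p ((toroidalData Φ n).pair (0, omega m v))) (x) : p x := by
  refine ext_induction _ hadd hmono (fun q => ?_) x
  refine omega_induction (p := fun q => p ((toroidalData Φ n).pair (0, q))) (fun x y hx hy => ?_)
    homega q
  have : ((0 : Loop (Fin n → ℤ) 𝔤), x + y) = (0, x) + (0, y) := by simp
  rw [this, map_add]
  exact hadd _ _ hx hy

/-- The action of `D` on `𝔤 ⊗ A ⊕ Ω_A / d_A`. -/
def degreeAction : Degrees n →ₗ⁅ℂ⁆ LieDerivation ℂ (ToroidalCore Φ n) (ToroidalCore Φ n) where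
  toFun := coreDer Φ n
  map_add' c c' := by
    ext x
    rw [LieDerivation.add_apply]
    induction x using core_induction with
    | hadd x y hx hy => simp only [map_add, hx, hy]; abel
    | hmono r X => simp only [coreDer_mono, map_add, AddMonoidHom.add_apply, add_smul]
    | homega m v => simp only [coreDer_omega, map_add, AddMonoidHom.add_apply, add_smul]
  map_smul' a c := by
    ext x
    rw [RingHom.id_apply, LieDerivation.smul_apply]
    induction x using core_induction with
    | hadd x y hx hy => simp only [map_add, hx, hy, smul_add]
    | hmono r X => simp only [coreDer_mono, map_smul, AddMonoidHom.smul_apply, smul_assoc]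
    | homega m v => simp only [coreDer_omega, map_smul, AddMonoidHom.smul_apply, smul_assoc]
  map_lie' {c c'} := by
    have h0 : coreDer Φ n 0 = 0 := by
      ext x
      rw [LieDerivation.zero_apply]
      induction x using core_induction with
      | hadd x y hx hy => simp only [map_add, hx, hy, add_zero]
      | hmono r X => simp [coreDer_mono]
      | homega m v => simp [coreDer_omega]
    rw [Degrees.lie_eq_zero]
    change coreDer Φ n 0 = _
    rw [h0]
    ext x
    rw [LieDerivation.commutator_apply, LieDerivation.zero_apply]
    induction x using core_induction with
    | hadd x y hx hy =>
      rw [eq_comm, sub_eq_zero] at hx hy ⊢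
      simp only [map_add, hx, hy]
    | hmono r X => simp only [coreDer_mono, map_smul, smul_comm (weight c r), sub_self]
    | homega m v => simp only [coreDer_omega, map_smul, smul_comm (weight c m), sub_self]

/-- The toroidal Lie algebra `τ = 𝔤 ⊗ A ⊕ Ω_A / d_A ⊕ D`. -/
abbrev Tau : Type _ := LieAlgebra.SemiDirectSum (ToroidalCore Φ n) (Degrees n) (degreeAction Φ n)

namespace Tau

variable {n}

/-- The element `X(r) = X ⊗ t^r` of `τ`. -/
def x (r : Fin n → ℤ) (X : 𝔤) : Tau Φ n := ⟨(toroidalData Φ n).pair (mono r X, 0), 0⟩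

/-- The inclusion of `Z = Ω_A / d_A` in `τ`. -/
def z (w : Omega n) : Tau Φ n := ⟨(toroidalData Φ n).pair (0, w), 0⟩

/-- The element `t^m K_i` of `τ`. -/
def tK (m : Fin n → ℤ) (i : Fin n) : Tau Φ n := z Φ (omega m (Pi.single i 1))

/-- The element `d_i` of `τ`. -/
def d (i : Fin n) : Tau Φ n := ⟨0, Degrees.basis i⟩

/-! The defining relations of `τ`. -/

lemma zLin (w : Omega n) : z Φ w = LieAlgebra.SemiDirectSum.inl (degreeAction Φ n)
    ((toroidalData Φ n).pair (0, w)) := rfl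

lemma sum_smul_tK_eq_z (m : Fin n → ℤ) (v : Fin n → ℂ) :
    ∑ i, v i • tK Φ m i = z Φ (omega m v) := by
  have h : ∀ w : Omega n, z Φ w = ((LieAlgebra.SemiDirectSum.inl (degreeAction Φ n)).toLinearMap ∘ₗ
      (toroidalData Φ n).pair.toLinearMap ∘ₗ LinearMap.inr ℂ _ _) w := fun w => rfl
  simp only [tK, h, ← map_smul, ← map_sum]
  congr 2
  ext i
  simp [Finset.sum_apply, Pi.single_apply]

lemma sum_smul_tK (m : Fin n → ℤ) : ∑ i, (m i : ℂ) • tK Φ m i = 0 := by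
  rw [sum_smul_tK_eq_z, omega_self, zLin]
  exact map_zero _

lemma x_lie_x (r s : Fin n → ℤ) (X Y : 𝔤) :
    ⁅x Φ r X, x Φ s Y⁆ = x Φ (r + s) ⁅X, Y⁆ + Φ.form X Y • ∑ i, (r i : ℂ) • tK Φ (r + s) i := by
  rw [sum_smul_tK_eq_z]
  have h : ⁅(toroidalData Φ n).pair (mono r X, 0), (toroidalData Φ n).pair (mono s Y, 0)⁆ =
      (toroidalData Φ n).pair (mono (r + s) ⁅X, Y⁆, 0) +
        Φ.form X Y • (toroidalData Φ n).pair (0, omega (r + s) fun i => (r i : ℂ)) := by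
    rw [pair_lie, ← map_smul, ← map_add]
    simp [toroidalData]
  simp [x, z, h]

lemma z_lie_x (w : Omega n) (r : Fin n → ℤ) (X : 𝔤) : ⁅z Φ w, x Φ r X⁆ = 0 := by
  simp [z, x, pair_lie]

lemma z_lie_z (w w' : Omega n) : ⁅z Φ w, z Φ w'⁆ = 0 := by
  simp [z, pair_lie]

lemma weight_single (i : Fin n) (r : Fin n → ℤ) :
    weight (Degrees.basis i) r = r i := by
  refine (weight_apply (Degrees.basis i) r).trans ?_
  change ∑ j, (Pi.single i 1 : Fin n → ℂ) j * (r j : ℂ) = r i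
  simp [Pi.single_apply]

lemma d_lie_x (i : Fin n) (r : Fin n → ℤ) (X : 𝔤) : ⁅d Φ i, x Φ r X⁆ = (r i : ℂ) • x Φ r X := by
  have h := coreDer_mono Φ n (Degrees.basis i) r X
  rw [weight_single] at h
  have h' : degreeAction Φ n (Degrees.basis i) ((toroidalData Φ n).pair (mono r X, 0)) = _ := h
  simp [d, x, h']

lemma d_lie_tK (i j : Fin n) (m : Fin n → ℤ) : ⁅d Φ i, tK Φ m j⁆ = (m i : ℂ) • tK Φ m j := by
  have h := coreDer_omega Φ n (Degrees.basis i) m (Pi.single j 1)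
  rw [weight_single] at h
  have h' : degreeAction Φ n (Degrees.basis i)
    ((toroidalData Φ n).pair (0, omega m (Pi.single j 1))) = _ := h
  simp [d, tK, z, h']

lemma d_lie_d (i j : Fin n) : ⁅d Φ i, d Φ j⁆ = 0 := by
  simp [d, Degrees.lie_eq_zero (Degrees.basis i) (Degrees.basis j)]

end Tau

/-! ### The action of `GL(n, ℤ)` -/

lemma cast_mulVec (B : Matrix (Fin n) (Fin n) ℤ) (r : Fin n → ℤ) :
    (B.map (Int.cast : ℤ → ℂ)).mulVec (fun i => (r i : ℂ)) = fun i => ((B.mulVec r) i : ℂ) := by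
  ext i
  simp [Matrix.mulVec, dotProduct]

/-- `X(r) ↦ X(B r)` and `d(t^r) t^s ↦ d(t^(B r)) t^(B s)` on `𝔤 ⊗ A ⊕ Ω_A / d_A`. -/
def coreGL (B : Matrix.GeneralLinearGroup (Fin n) ℤ) :
    ToroidalCore Φ n →ₗ⁅ℂ⁆ ToroidalCore Φ n :=
  extLift (toroidalData Φ n)
    (fun r => (toroidalData Φ n).pair.toLinearMap ∘ₗ LinearMap.inl ℂ _ _ ∘ₗ mono (B.1.mulVec r))
    ((toroidalData Φ n).pair.toLinearMap ∘ₗ LinearMap.inr ℂ _ _ ∘ₗ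
      omegaLift (fun m => omega (B.1.mulVec m) ∘ₗ (B.1.map (Int.cast : ℤ → ℂ)).mulVecLin)
        fun m => by
          rw [LinearMap.comp_apply, Matrix.mulVecLin_apply, cast_mulVec, omega_self])
    (fun r s X Y => by
      simp only [LinearMap.comp_apply, LinearEquiv.coe_coe, LinearMap.inl_apply,
        LinearMap.inr_apply, pair_lie, ← map_smul, ← map_add]
      refine congrArg _ (Prod.ext ?_ ?_)
      · simp [Matrix.mulVec_add]
      · change pairing Φ _ _ _ = 0 + (Φ.form X Y • (0, omegaLift _ _ (omega _ _)) : _ × _).2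
        rw [pairing_mono, omegaLift_omega, LinearMap.comp_apply, Matrix.mulVecLin_apply,
          cast_mulVec, Matrix.mulVec_add]
        simp [toroidalData])
    (fun p r X => by simp [pair_lie])
    (fun p q => by simp [pair_lie])

lemma coreGL_mono (B : Matrix.GeneralLinearGroup (Fin n) ℤ) (r : Fin n → ℤ) (X : 𝔤) :
    coreGL Φ n B ((toroidalData Φ n).pair (mono r X, 0)) =
      (toroidalData Φ n).pair (mono (B.1.mulVec r) X, 0) := by
  refine (extLift_pair ..).trans ?_
  simp

lemma coreGL_omega (B : Matrix.GeneralLinearGroup (Fin n) ℤ) (m : Fin n → ℤ) (v : Fin n → ℂ) :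
    coreGL Φ n B ((toroidalData Φ n).pair (0, omega m v)) =
      (toroidalData Φ n).pair
        (0, omega (B.1.mulVec m) ((B.1.map (Int.cast : ℤ → ℂ)).mulVec v)) := by
  refine (extLift_pair ..).trans ?_
  simp

/-- The automorphism of `D` with `d_i ↦ ∑ j, (B⁻¹)_{ij} d_j`. -/
def degreesGL (B : Matrix.GeneralLinearGroup (Fin n) ℤ) : Degrees n →ₗ⁅ℂ⁆ Degrees n where
  toLinearMap := ((B⁻¹).1.map (Int.cast : ℤ → ℂ)).vecMulLinear
  map_lie' := map_zero ((B⁻¹).1.map (Int.cast : ℤ → ℂ)).vecMulLinear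

lemma degreesGL_apply (B : Matrix.GeneralLinearGroup (Fin n) ℤ) (c : Fin n → ℂ) :
    degreesGL n B c = Matrix.vecMul c ((B⁻¹).1.map (Int.cast : ℤ → ℂ)) := rfl

lemma weight_degreesGL (B : Matrix.GeneralLinearGroup (Fin n) ℤ) (c : Degrees n)
    (r : Fin n → ℤ) : weight (degreesGL n B c) (B.1.mulVec r) = weight c r := by
  have hB : (B⁻¹).1.mulVec (B.1.mulVec r) = r := by
    rw [Matrix.mulVec_mulVec, ← Units.val_mul, inv_mul_cancel, Units.val_one, Matrix.one_mulVec]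
  refine (Matrix.dotProduct_mulVec (m := Fin n) c ((B⁻¹).1.map (Int.cast : ℤ → ℂ))
    (fun i => ((B.1.mulVec r) i : ℂ))).symm.trans ?_
  rw [cast_mulVec, hB]
  rfl

/-- The endomorphism of `τ` attached to `B ∈ GL(n, ℤ)`. -/
def tauGLHom (B : Matrix.GeneralLinearGroup (Fin n) ℤ) : Tau Φ n →ₗ⁅ℂ⁆ Tau Φ n :=
  semiMap (coreGL Φ n B) (degreesGL n B) <| by
    intro c x
    change coreGL Φ n B (coreDer Φ n c x) = coreDer Φ n (degreesGL n B c) (coreGL Φ n B x)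
    induction x using core_induction with
    | hadd x y hx hy => simp only [map_add, hx, hy]
    | hmono r X => rw [coreDer_mono, map_smul, coreGL_mono, coreDer_mono, weight_degreesGL]
    | homega m v => rw [coreDer_omega, map_smul, coreGL_omega, coreDer_omega, weight_degreesGL]

lemma tauGLHom_apply_apply (B C : Matrix.GeneralLinearGroup (Fin n) ℤ) (h : B * C = 1)
    (y : Tau Φ n) : tauGLHom Φ n B (tauGLHom Φ n C y) = y := by
  have hBC : B.1 * C.1 = 1 := by rw [← Units.val_mul, h, Units.val_one]
  have hBC' : B.1.map (Int.cast : ℤ → ℂ) * C.1.map (Int.cast : ℤ → ℂ) = 1 := by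
    have := Matrix.map_mul (L := B.1) (M := C.1) (f := Int.castRingHom ℂ)
    rw [hBC] at this
    simpa using this.symm
  refine LieAlgebra.SemiDirectSum.ext ?_ ?_
  · change coreGL Φ n B (coreGL Φ n C y.left) = y.left
    generalize y.left = a
    induction a using core_induction with
    | hadd x y hx hy => simp only [map_add, hx, hy]
    | hmono r X =>
      rw [coreGL_mono, coreGL_mono, Matrix.mulVec_mulVec, hBC, Matrix.one_mulVec]
    | homega m v =>
      rw [coreGL_omega, coreGL_omega, Matrix.mulVec_mulVec, Matrix.mulVec_mulVec, hBC, hBC',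
        Matrix.one_mulVec, Matrix.one_mulVec]
  · change degreesGL n B (degreesGL n C y.right) = y.right
    have hi : C⁻¹ = B := (eq_inv_of_mul_eq_one_left h).symm
    have hi' : B⁻¹ = C := by rw [← hi, inv_inv]
    refine (Matrix.vecMul_vecMul (n := Fin n) y.right ((C⁻¹).1.map (Int.cast : ℤ → ℂ))
      ((B⁻¹).1.map (Int.cast : ℤ → ℂ))).trans ?_
    rw [hi, hi', hBC']
    exact Matrix.vecMul_one y.right

/-- The automorphism of `τ` attached to `B ∈ GL(n, ℤ)`: `X(r) ↦ X(B r)`,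
`d(t^r) t^s ↦ d(t^(B r)) t^(B s)` and `d_i ↦ ∑ j, (B⁻¹)_{ij} d_j`. -/
def tauGL (B : Matrix.GeneralLinearGroup (Fin n) ℤ) : Tau Φ n ≃ₗ⁅ℂ⁆ Tau Φ n where
  toLieHom := tauGLHom Φ n B
  invFun := tauGLHom Φ n B⁻¹
  left_inv := tauGLHom_apply_apply Φ n _ _ (inv_mul_cancel B)
  right_inv := tauGLHom_apply_apply Φ n _ _ (mul_inv_cancel B)

lemma tauGL_x (B : Matrix.GeneralLinearGroup (Fin n) ℤ) (r : Fin n → ℤ) (X : 𝔤) :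
    tauGL Φ n B (Tau.x Φ r X) = Tau.x Φ (B.1.mulVec r) X :=
  LieAlgebra.SemiDirectSum.ext (coreGL_mono Φ n B r X) (map_zero (degreesGL n B))

lemma tauGL_z (B : Matrix.GeneralLinearGroup (Fin n) ℤ) (r s : Fin n → ℤ) :
    tauGL Φ n B (Tau.z Φ (omega (r + s) fun i => (r i : ℂ))) =
      Tau.z Φ (omega (B.1.mulVec r + B.1.mulVec s) fun i => (B.1.mulVec r i : ℂ)) := by
  refine LieAlgebra.SemiDirectSum.ext ?_ (map_zero (degreesGL n B))
  refine (coreGL_omega Φ n B _ _).trans ?_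
  rw [cast_mulVec, Matrix.mulVec_add]
  rfl

/-! ### The Lie algebra `𝔤_aff ⊗ A_{n-1} ⊕ D`, with `n = N + 1` -/

/-- The cocycle data `β(r, s) = r δ_{r+s,0}` on `𝔤 ⊗ ℂ[t^±¹]`. -/
def affineData : CentralData 𝔤 ℤ ℂ where
  Φ := Φ
  β r s := if r + s = 0 then (r : ℂ) else 0
  skew r s := by
    rcases eq_or_ne (r + s) 0 with h | h
    · rw [if_pos h, if_pos (by omega), eq_neg_of_add_eq_zero_right h]
      simp
    · rw [if_neg h, if_neg (by omega), neg_zero]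
  cyclic r s u := by
    rcases eq_or_ne (r + s + u) 0 with h | h
    · rw [if_pos h, if_pos (by omega), if_pos (by omega)]
      have : (r : ℂ) + s + u = 0 := by exact_mod_cast h
      push_cast
      linear_combination 2 * this
    · rw [if_neg h, if_neg (by omega), if_neg (by omega)]
      simp

/-- `𝔤_aff = 𝔤 ⊗ ℂ[t^±¹] ⊕ ℂ K`. -/
abbrev Affine : Type _ := CentralExt (affineData Φ)

/-- The multiple `a • t d/dt` of the degree derivation of `𝔤_aff`. -/
def affineDer (a : ℂ) : LieDerivation ℂ (Affine Φ) (Affine Φ) :=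
  extDer (affineData Φ) ((AddMonoidHom.mulLeft a).comp (Int.castAddHom ℂ)) 0 fun r s => by
    change 0 = (a * (r : ℂ) + a * (s : ℂ)) • (if r + s = 0 then (r : ℂ) else 0)
    split_ifs with h
    · have h' : (r : ℂ) + s = 0 := by exact_mod_cast h
      rw [← mul_add, h', mul_zero, zero_smul]
    · simp

lemma affineDer_mono (a : ℂ) (r : ℤ) (X : 𝔤) :
    affineDer Φ a ((affineData Φ).pair (mono r X, 0)) =
      (a * (r : ℂ)) • (affineData Φ).pair (mono r X, 0) := by
  refine (extDer_pair ..).trans ?_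
  rw [← map_smul]
  simp

lemma affineDer_central (a : ℂ) (p : ℂ) : affineDer Φ a ((affineData Φ).pair (0, p)) = 0 := by
  refine (extDer_pair ..).trans ?_
  simp

variable (N : ℕ)

/-- The derivation `∑ i, c_i d_i` of `𝔤_aff ⊗ A_N`: the derivations `d_1, …, d_N` act on `A_N` and
the last one acts on `𝔤_aff`. -/
def affineCoreDer (c : Degrees (N + 1)) :
    LieDerivation ℂ (Loop (Fin N → ℤ) (Affine Φ)) (Loop (Fin N → ℤ) (Affine Φ)) :=
  loopDer (weight (fun j : Fin N => c j.castSucc)) (affineDer Φ (c (Fin.last N)))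

lemma affineCoreDer_mono (c : Degrees (N + 1)) (m : Fin N → ℤ) (r : ℤ) (X : 𝔤) :
    affineCoreDer Φ N c (mono m ((affineData Φ).pair (mono r X, 0))) =
      (weight (fun j : Fin N => c j.castSucc) m + c (Fin.last N) * (r : ℂ)) •
        mono m ((affineData Φ).pair (mono r X, 0)) := by
  rw [affineCoreDer, loopDer_mono, affineDer_mono, map_smul, add_smul]

lemma affineCoreDer_central (c : Degrees (N + 1)) (m : Fin N → ℤ) (p : ℂ) :
    affineCoreDer Φ N c (mono m ((affineData Φ).pair (0, p))) =
      weight (fun j : Fin N => c j.castSucc) m • mono m ((affineData Φ).pair (0, p)) := by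
  rw [affineCoreDer, loopDer_mono, affineDer_central, map_zero, add_zero]

lemma affineCore_induction {p : Loop (Fin N → ℤ) (Affine Φ) → Prop}
    (hadd : ∀ x y, p x → p y → p (x + y))
    (hmono : ∀ m r X, p (mono m ((affineData Φ).pair (mono r X, 0))))
    (hcentral : ∀ m q, p (mono m ((affineData Φ).pair (0, q)))) (x) : p x := by
  induction x using loop_induction with
  | h0 =>
    have := hcentral 0 0
    rwa [← Prod.zero_eq_mk, map_zero, map_zero] at this
  | hadd x y hx hy => exact hadd x y hx hy
  | hmono m Y =>
    induction Y using ext_induction with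
    | hadd x y hx hy => rw [map_add]; exact hadd _ _ hx hy
    | hmono r X => exact hmono m r X
    | hcentral q => exact hcentral m q

lemma weight_castSucc_add (c c' : Degrees (N + 1)) (m : Fin N → ℤ) :
    weight (fun j : Fin N => (c + c') j.castSucc) m =
      weight (fun j : Fin N => c j.castSucc) m + weight (fun j : Fin N => c' j.castSucc) m :=
  DFunLike.congr_fun
    (map_add weight (fun j : Fin N => c j.castSucc : Degrees N) (fun j : Fin N => c' j.castSucc)) m

lemma weight_castSucc_smul (a : ℂ) (c : Degrees (N + 1)) (m : Fin N → ℤ) :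
    weight (fun j : Fin N => (a • c) j.castSucc) m =
      a * weight (fun j : Fin N => c j.castSucc) m :=
  DFunLike.congr_fun (map_smul weight a (fun j : Fin N => c j.castSucc : Degrees N)) m

/-- The action of `D` on `𝔤_aff ⊗ A_N`. -/
def affineDegreeAction : Degrees (N + 1) →ₗ⁅ℂ⁆
    LieDerivation ℂ (Loop (Fin N → ℤ) (Affine Φ)) (Loop (Fin N → ℤ) (Affine Φ)) where
  toFun := affineCoreDer Φ N
  map_add' c c' := by
    have e : (c + c') (Fin.last N) = c (Fin.last N) + c' (Fin.last N) := rfl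
    ext x
    rw [LieDerivation.add_apply]
    induction x using affineCore_induction with
    | hadd x y hx hy => simp only [map_add, hx, hy]; abel
    | hmono m r X =>
      simp only [affineCoreDer_mono, weight_castSucc_add, e]
      module
    | hcentral m q =>
      simp only [affineCoreDer_central, weight_castSucc_add]
      module
  map_smul' a c := by
    have e : (a • c) (Fin.last N) = a * c (Fin.last N) := rfl
    ext x
    rw [RingHom.id_apply, LieDerivation.smul_apply]
    induction x using affineCore_induction with
    | hadd x y hx hy => simp only [map_add, hx, hy, smul_add]
    | hmono m r X =>
      simp only [affineCoreDer_mono, weight_castSucc_smul, e]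
      module
    | hcentral m q =>
      simp only [affineCoreDer_central, weight_castSucc_smul]
      module
  map_lie' {c c'} := by
    have h0 : affineCoreDer Φ N 0 = 0 := by
      have w : ∀ m, weight (fun j : Fin N => (0 : Degrees (N + 1)) j.castSucc) m = 0 := fun m =>
        DFunLike.congr_fun (map_zero weight) m
      have e : (0 : Degrees (N + 1)) (Fin.last N) = 0 := rfl
      ext x
      rw [LieDerivation.zero_apply]
      induction x using affineCore_induction with
      | hadd x y hx hy => simp only [map_add, hx, hy, add_zero]
      | hmono m r X => simp [affineCoreDer_mono, w, e]
      | hcentral m q => simp [affineCoreDer_central, w]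
    rw [Degrees.lie_eq_zero]
    change affineCoreDer Φ N 0 = _
    rw [h0]
    ext x
    rw [LieDerivation.commutator_apply, LieDerivation.zero_apply]
    induction x using affineCore_induction with
    | hadd x y hx hy =>
      rw [eq_comm, sub_eq_zero] at hx hy ⊢
      simp only [map_add, hx, hy]
    | hmono m r X =>
      simp only [affineCoreDer_mono, map_smul]
      module
    | hcentral m q =>
      simp only [affineCoreDer_central, map_smul]
      module

/-- `𝔤_aff ⊗ A_N ⊕ D`. -/
abbrev AffTau : Type _ :=
  LieAlgebra.SemiDirectSum (Loop (Fin N → ℤ) (Affine Φ)) (Degrees (N + 1)) (affineDegreeAction Φ N)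

/-- The homomorphism `𝔤 ⊗ A_{N+1} ⊕ Z → 𝔤_aff ⊗ A_N` with
`X ⊗ t^r ↦ (X ⊗ t_{N+1}^{r_{N+1}}) ⊗ t^(r_1, …, r_N)`, with `t^m K_{N+1} ↦ K ⊗ t^(m_1, …, m_N)` when
`m_{N+1} = 0`, and with all other `t^m K_i ↦ 0`. -/
def corePhi : ToroidalCore Φ (N + 1) →ₗ⁅ℂ⁆ Loop (Fin N → ℤ) (Affine Φ) :=
  extLift (toroidalData Φ (N + 1))
    (fun r => mono (fun j : Fin N => r j.castSucc) ∘ₗ (affineData Φ).pair.toLinearMap ∘ₗ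
      LinearMap.inl ℂ _ _ ∘ₗ mono (r (Fin.last N)))
    (omegaLift (fun m => if m (Fin.last N) = 0 then
        mono (fun j : Fin N => m j.castSucc) ∘ₗ (affineData Φ).pair.toLinearMap ∘ₗ
          LinearMap.inr ℂ _ _ ∘ₗ LinearMap.proj (Fin.last N)
      else 0) fun m => by
        split_ifs with h
        · simp only [LinearMap.comp_apply, LinearEquiv.coe_coe, LinearMap.inr_apply,
            LinearMap.proj_apply, h, Int.cast_zero, pair_zero_zero, map_zero]
        · simp)
    (fun r s X Y => by
      change _ = _ + Φ.form X Y • omegaLift _ _ (omega (r + s) fun i => (r i : ℂ))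
      rw [omegaLift_omega]
      simp only [LinearMap.comp_apply, LinearEquiv.coe_coe, LinearMap.inl_apply, mono_lie, pair_lie]
      change mono (fun j : Fin N => (r + s) j.castSucc) ((affineData Φ).pair
        (_, pairing Φ (affineData Φ).β (mono _ X) (mono _ Y))) = _
      rw [pairing_mono]
      by_cases h : (r + s) (Fin.last N) = 0
      · have h' : r (Fin.last N) + s (Fin.last N) = 0 := h
        rw [if_pos h]
        simp only [LinearMap.comp_apply, LinearEquiv.coe_coe, LinearMap.inr_apply,
          LinearMap.proj_apply, ← map_smul, ← map_add]
        simp only [affineData, h', Pi.add_apply, if_true, Prod.smul_mk, Prod.mk_add_mk, smul_zero,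
          add_zero, zero_add]
        rfl
      · have h' : ¬ r (Fin.last N) + s (Fin.last N) = 0 := h
        rw [if_neg h]
        simp only [affineData, h', if_false, smul_zero, add_zero, LinearMap.zero_apply,
          LinearMap.comp_apply, LinearEquiv.coe_coe, LinearMap.inl_apply, Pi.add_apply]
        rfl)
    (fun p r X => by
      induction p using omega_induction with
      | hadd x y hx hy => rw [map_add, add_lie, hx, hy, add_zero]
      | h m v =>
        rw [omegaLift_omega]
        split_ifs
        · simp only [LinearMap.comp_apply, LinearEquiv.coe_coe, mono_lie, pair_lie,
            LinearMap.inr_apply, LinearMap.inl_apply, zero_lie, map_zero, LinearMap.zero_apply,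
            pair_zero_zero]
        · simp)
    (fun p q => by
      induction p using omega_induction with
      | hadd x y hx hy => rw [map_add, add_lie, hx, hy, add_zero]
      | h m v =>
        induction q using omega_induction with
        | hadd x y hx hy => rw [map_add, lie_add, hx, hy, add_zero]
        | h m' v' =>
          rw [omegaLift_omega, omegaLift_omega]
          split_ifs <;> simp only [LinearMap.comp_apply, LinearEquiv.coe_coe, mono_lie, pair_lie,
            LinearMap.inr_apply, zero_lie, lie_zero, map_zero, LinearMap.zero_apply,
            pair_zero_zero])

lemma corePhi_mono (r : Fin (N + 1) → ℤ) (X : 𝔤) :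
    corePhi Φ N ((toroidalData Φ (N + 1)).pair (mono r X, 0)) =
      mono (fun j : Fin N => r j.castSucc) ((affineData Φ).pair (mono (r (Fin.last N)) X, 0)) := by
  refine (extLift_pair ..).trans ?_
  simp

lemma corePhi_omega (m : Fin (N + 1) → ℤ) (v : Fin (N + 1) → ℂ) :
    corePhi Φ N ((toroidalData Φ (N + 1)).pair (0, omega m v)) =
      if m (Fin.last N) = 0 then
        mono (fun j : Fin N => m j.castSucc) ((affineData Φ).pair (0, v (Fin.last N)))
      else 0 := by
  refine (extLift_pair ..).trans ?_
  split_ifs with h <;> simp [h]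

/-- The homomorphism `φ : τ → 𝔤_aff ⊗ A_N ⊕ D`, which is the identity on `D`. -/
def phi : Tau Φ (N + 1) →ₗ⁅ℂ⁆ AffTau Φ N :=
  semiMap (corePhi Φ N) LieHom.id <| by
    intro c x
    change corePhi Φ N (coreDer Φ (N + 1) c x) = affineCoreDer Φ N c (corePhi Φ N x)
    have hw : ∀ r : Fin (N + 1) → ℤ, weight c r =
        weight (fun j : Fin N => c j.castSucc) (fun j : Fin N => r j.castSucc) +
          c (Fin.last N) * (r (Fin.last N) : ℂ) := fun r => by
      rw [weight_apply, Fin.sum_univ_castSucc]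
      rfl
    induction x using core_induction with
    | hadd x y hx hy => simp only [map_add, hx, hy]
    | hmono r X => rw [coreDer_mono, map_smul, corePhi_mono, affineCoreDer_mono, hw]
    | homega m v =>
      rw [coreDer_omega, map_smul, corePhi_omega]
      split_ifs with h
      · rw [affineCoreDer_central, hw, h]
        simp
      · simp

lemma phi_x (r : Fin (N + 1) → ℤ) (X : 𝔤) :
    phi Φ N (Tau.x Φ r X) =
      ⟨mono (fun j : Fin N => r j.castSucc) ((affineData Φ).pair (mono (r (Fin.last N)) X, 0)), 0⟩ :=
  LieAlgebra.SemiDirectSum.ext (corePhi_mono Φ N r X) rfl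

lemma phi_tK (m : Fin (N + 1) → ℤ) (i : Fin (N + 1)) :
    phi Φ N (Tau.tK Φ m i) =
      if i = Fin.last N ∧ m (Fin.last N) = 0 then
        ⟨mono (fun j : Fin N => m j.castSucc) ((affineData Φ).pair (0, 1)), 0⟩
      else 0 := by
  refine LieAlgebra.SemiDirectSum.ext ((corePhi_omega Φ N m _).trans ?_) ?_
  · by_cases hm : m (Fin.last N) = 0 <;> by_cases hi : i = Fin.last N <;>
      simp [hm, hi, Pi.single_apply, eq_comm]
  · split_ifs <;> rfl

lemma phi_d (i : Fin (N + 1)) : phi Φ N (Tau.d Φ i) = ⟨0, Degrees.basis i⟩ :=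
  LieAlgebra.SemiDirectSum.ext (map_zero (corePhi Φ N)) rfl

/-! ### Modules -/

/-- The Cartan subalgebra of `τ`: the span of a Cartan subalgebra `𝔥` of `𝔤` and of the `K_i` and
the `d_i`. -/
def cartan (𝔥 : LieSubalgebra ℂ 𝔤) : Submodule ℂ (Tau Φ n) :=
  Submodule.span ℂ (Tau.x Φ 0 '' 𝔥 ∪ Set.range (Tau.tK Φ 0) ∪ Set.range (Tau.d Φ))

variable (V : Type*) [AddCommGroup V] [Module ℂ V] [LieRingModule (Tau Φ n) V]
  [LieModule ℂ (Tau Φ n) V]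

/-- The weight space `V_lam = {v | h v = lam(h) v for all h in the Cartan subalgebra}`. -/
def weightSpace (𝔥 : LieSubalgebra ℂ 𝔤) (lam : Module.Dual ℂ (cartan Φ n 𝔥)) :
    Submodule ℂ V where
  carrier := {v | ∀ h : cartan Φ n 𝔥, ⁅(h : Tau Φ n), v⁆ = lam h • v}
  add_mem' hv hw h := by rw [lie_add, hv h, hw h, smul_add]
  zero_mem' h := by simp
  smul_mem' a v hv h := by rw [lie_smul, hv h, smul_comm]

/-- `V` is a weight module (the sum of its weight spaces) with finite-dimensional weight spaces. -/
structure IsFiniteWeightModule (𝔥 : LieSubalgebra ℂ 𝔤) : Prop where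
  iSup_eq_top : ⨆ lam, weightSpace Φ n V 𝔥 lam = ⊤
  finiteDimensional : ∀ lam, FiniteDimensional ℂ (weightSpace Φ n V 𝔥 lam)

/-- The degrees `m` for which some `t^m K_i` acts non-trivially on `V`, and their negatives. -/
def centralDegrees : Set (Fin n → ℤ) :=
  {r | ∃ m : Fin n → ℤ, (∃ i, ∃ v : V, ⁅Tau.tK Φ m i, v⁆ ≠ 0) ∧ (r = m ∨ r = -m)}

/-- The rank of the subgroup of `ℤⁿ` spanned by the degrees of the non-vanishing `t^m K_i`. -/
def centralRank : ℕ := Module.finrank ℤ (Submodule.span ℤ (centralDegrees Φ n V))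

end Toroidal

end

/-!
Let `V` be an irreducible weight module over `τ` with finite-dimensional weight spaces.

An element `∑ i, v_i t^m K_i` of `Z` commutes with `𝔤 ⊗ A ⊕ Z` and shifts the `d_i` by `m_i`, so its
kernel and its range are submodules of `V`: it is zero or invertible (`IsDegreeOp.bijective`). Hence
every degree in the lattice `Γ ⊆ ℤⁿ` spanned by the degrees of the non-zero `t^m K_i` is the degree
of an invertible operator commuting with `𝔤 ⊗ A`.

Choose `X` in the Cartan subalgebra with `(X, X) ≠ 0`. Then
`[X(r), X(s)] = (X, X) ∑ i, r_i t^(r+s) K_i`. If `r ∈ Γ`, the operator `∑ i, r_i t^m K_i` must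
vanish: otherwise invertible operators of degrees `r` and `m` turn `X(r)` and `X(m - r)` into
operators on a finite-dimensional weight space whose commutator is a non-zero scalar, against the
trace (`centralOp_eq_zero_of_mem_span`). So if `Z` acts non-trivially, `Γ` does not have rank `n`.

If the rank were less than `n - 1`, there would be a plane in `ℤⁿ` independent of `Γ` and a degree
`m` such that the operators `∑ i, r_i t^m K_i` are non-zero for all `r` in the plane off a line. The
`X(r)` and the conjugates `X(m - r)`, moved by an operator of degree `m`, then form a Heisenberg
algebra graded by `ℤ²` acting on a graded space with finite-dimensional components
(`false_of_independent_plane`). This is impossible (`eq_bot_of_heisenberg`): on a joint eigenvector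
of the number operators `x (-s) x s`, at least one of the two eigenvalues for `s` and `-s` is
non-zero. A combinatorial argument shows that some degree is a sum of two degrees with non-zero
eigenvalues in infinitely many ways, and the resulting vectors of that degree are linearly
independent. So `Γ` has rank `n - 1`.

A basis of `ℤⁿ` from the Smith normal form of `Γ` (`exists_adapted_basis`) has `n - 1` vectors with
non-zero multiples in `Γ`. With the remaining vector placed last, it is the change of coordinates
`B`, after which the `t^m K_i` in the kernel of `φ` act by zero. As `φ` has a linear section, the
module then factors through `φ` (`exists_module_of_central_eq_zero`).
-/

noncomputable section

set_option linter.unusedSimpArgs false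
set_option linter.unusedSectionVars false

namespace Toroidal

/-! ### Linear algebra -/

section LinearAlgebra

variable {V : Type*} [AddCommGroup V] [Module ℂ V]

/-- A trace argument: two operators preserving a non-zero finite-dimensional subspace cannot have
a non-zero scalar as their commutator. -/
lemma eq_zero_of_commutator_eq_smul {W : Submodule ℂ V} [FiniteDimensional ℂ W] (hW : W ≠ ⊥)
    {A B : Module.End ℂ V} (hA : ∀ v ∈ W, A v ∈ W) (hB : ∀ v ∈ W, B v ∈ W) {c : ℂ}
    (h : ∀ v, A (B v) - B (A v) = c • v) : c = 0 := by
  have e : A.restrict hA * B.restrict hB - B.restrict hB * A.restrict hA = c • 1 := by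
    ext v
    exact h v
  have t := congrArg (LinearMap.trace ℂ W) e
  rw [map_sub, LinearMap.trace_mul_comm, sub_self, map_smul, LinearMap.trace_one, smul_eq_mul,
    eq_comm, mul_eq_zero, Nat.cast_eq_zero] at t
  refine t.resolve_right fun h0 => hW ?_
  exact Submodule.finrank_eq_zero.mp h0

/-- Commuting operators which preserve a non-zero finite-dimensional subspace have a joint
eigenvector there, even when there are infinitely many of them. -/
lemma exists_joint_eigenvector {ι : Type*} {f : ι → Module.End ℂ V}
    (hf : ∀ i j v, f i (f j v) = f j (f i v)) {W : Submodule ℂ V} [FiniteDimensional ℂ W]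
    (hW : W ≠ ⊥) (hfW : ∀ i, ∀ v ∈ W, f i v ∈ W) :
    ∃ v ∈ W, v ≠ 0 ∧ ∀ i, ∃ μ : ℂ, f i v = μ • v := by
  induction hn : Module.finrank ℂ W using Nat.strong_induction_on generalizing W with
  | _ n ih =>
    by_cases hs : ∀ i, ∃ μ : ℂ, ∀ v ∈ W, f i v = μ • v
    · obtain ⟨v, hv, hv0⟩ := W.ne_bot_iff.mp hW
      exact ⟨v, hv, hv0, fun i => (hs i).imp fun μ h => h v hv⟩
    · push Not at hs
      obtain ⟨i, hi⟩ := hs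
      have : Nontrivial W := Submodule.nontrivial_iff_ne_bot.mpr hW
      obtain ⟨μ, hμ⟩ := Module.End.exists_eigenvalue ((f i).restrict (hfW i))
      obtain ⟨w, hw⟩ := hμ.exists_hasEigenvector
      let E : Submodule ℂ V := W ⊓ Module.End.eigenspace (f i) μ
      have hE : ∀ v, v ∈ E ↔ v ∈ W ∧ f i v = μ • v := fun v => by
        rw [Submodule.mem_inf, Module.End.mem_eigenspace_iff]
      have hEW : E < W := by
        refine lt_of_le_of_ne inf_le_left fun h => ?_
        obtain ⟨v, hv, hv'⟩ := hi μ
        exact hv' ((hE v).mp (h ▸ hv)).2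
      have hE0 : E ≠ ⊥ := by
        refine E.ne_bot_iff.mpr ⟨w, (hE _).mpr ⟨w.2, ?_⟩, fun h => hw.2 (Subtype.ext h)⟩
        exact congrArg Subtype.val hw.apply_eq_smul
      have : FiniteDimensional ℂ E := Submodule.finiteDimensional_of_le hEW.le
      obtain ⟨v, hv, h⟩ := ih _ (hn ▸ Submodule.finrank_lt_finrank_of_lt hEW) hE0
        (fun j v hv => (hE _).mpr ⟨hfW j v ((hE v).mp hv).1, by
          rw [hf, ((hE v).mp hv).2, map_smul]⟩) rfl
      exact ⟨v, hEW.le hv, h⟩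

end LinearAlgebra

/-! ### Heisenberg algebras graded by `ℤ²` -/

section Heisenberg

/-- If the set `S ⊆ ℤ²` contains `s` or `-s` whenever `s` is off the vertical axis, then some
`r ≠ 0` is a sum of two elements of `S` off that axis in infinitely many ways. Otherwise `S` would
be invariant, up to finitely many exceptions, under each of the translations by `(±1, 0)` and
`(±2, 0)`; a horizontal row without exceptions is then contained in `S` or in its complement, and
this row or its negative gives infinitely many pairs with the same sum. -/
lemma exists_infinite_sum_decompositions {S : Set (ℤ × ℤ)}
    (hS : ∀ s : ℤ × ℤ, s.1 ≠ 0 → s ∈ S ∨ -s ∈ S) :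
    ∃ r : ℤ × ℤ, r ≠ 0 ∧ {s | s.1 ≠ 0 ∧ r.1 - s.1 ≠ 0 ∧ s ∈ S ∧ r - s ∈ S}.Infinite := by
  by_contra! hfin
  set F : ℤ × ℤ → Set (ℤ × ℤ) := fun r => {s | s.1 ≠ 0 ∧ r.1 - s.1 ≠ 0 ∧ s ∈ S ∧ r - s ∈ S}
  have hbad : (Prod.snd '' (F (1, 0) ∪ F (-1, 0) ∪ F (2, 0) ∪ F (-2, 0))).Finite :=
    ((((hfin _ (by simp)).union (hfin _ (by simp))).union (hfin _ (by simp))).union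
      (hfin _ (by simp))).image _
  obtain ⟨R, hR0, hR⟩ := (Set.Ioi_infinite (0 : ℤ)).exists_notMem_finset hbad.toFinset
  rw [Set.Finite.mem_toFinset] at hR
  have hR0' : 0 < R := hR0
  -- one step in the row of height `R`
  have step : ∀ k a : ℤ, k = 1 ∨ k = -1 ∨ k = 2 ∨ k = -2 → a ≠ 0 → a + k ≠ 0 →
      ((a, R) : ℤ × ℤ) ∈ S → ((a + k, R) : ℤ × ℤ) ∈ S := by
    intro k a hk ha hak haS
    have hn : ((a, R) : ℤ × ℤ) ∉ F (-k, 0) := by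
      intro hm
      refine hR ⟨(a, R), ?_, rfl⟩
      rcases hk with rfl | rfl | rfl | rfl <;> simp only [Set.mem_union] <;> tauto
    have h1 : ((-k, 0) : ℤ × ℤ) - (a, R) ∉ S := fun h => hn ⟨ha, by
      change -k - a ≠ 0
      omega, haS, h⟩
    have h2 := (hS (((-k, 0) : ℤ × ℤ) - (a, R)) (by
      change -k - a ≠ 0
      omega)).resolve_left h1
    convert h2 using 1
    ext <;> simp [add_comm]
  have row : ∀ a : ℤ, a ≠ 0 → (((a, R) : ℤ × ℤ) ∈ S ↔ ((1, R) : ℤ × ℤ) ∈ S) := by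
    have pos : ∀ n : ℕ, (((n + 1 : ℤ), R) ∈ S ↔ ((1, R) : ℤ × ℤ) ∈ S) := by
      intro n
      induction n with
      | zero => simp
      | succ n ih =>
        rw [← ih]
        constructor
        · intro h
          convert step (-1) _ (by simp) (by omega) (by omega) h using 2
          omega
        · intro h
          convert step 1 _ (by simp) (by omega) (by omega) h using 2
          omega
    have neg : ∀ n : ℕ, ((-(n + 1 : ℤ), R) ∈ S ↔ ((1, R) : ℤ × ℤ) ∈ S) := by
      intro n
      induction n with
      | zero =>
        constructor
        · intro h
          convert step 2 _ (by simp) (by omega) (by omega) h using 2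
          omega
        · intro h
          convert step (-2) _ (by simp) (by omega) (by omega) h using 2
          omega
      | succ n ih =>
        rw [← ih]
        constructor
        · intro h
          convert step 1 _ (by simp) (by omega) (by omega) h using 2
          push_cast
          ring
        · intro h
          convert step (-1) _ (by simp) (by omega) (by omega) h using 2
          push_cast
          ring
    intro a ha
    rcases lt_or_gt_of_ne ha with h | h
    · convert neg (-a - 1).toNat using 3
      omega
    · convert pos (a - 1).toNat using 3
      omega
  have conclude : ∀ b : ℤ, b ≠ 0 → ¬ ∀ a : ℤ, a ≠ 0 → ((a, b) : ℤ × ℤ) ∈ S := by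
    intro b hb h
    refine (hfin (0, 2 * b) (by simpa using hb)) |>.not_infinite ?_
    refine Set.infinite_of_injective_forall_mem (f := fun n : ℕ => (((n : ℤ) + 1, b) : ℤ × ℤ))
      (fun m n hmn => by simpa using hmn) fun n => ?_
    have e : ((0, 2 * b) : ℤ × ℤ) - ((n : ℤ) + 1, b) = (-((n : ℤ) + 1), b) := by
      ext <;> simp
      ring
    refine ⟨?_, ?_, h _ (by omega), ?_⟩
    · change (n : ℤ) + 1 ≠ 0
      omega
    · change (0 : ℤ) - (n + 1) ≠ 0
      omega
    · rw [e]
      exact h _ (by omega)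
  by_cases h1 : ((1, R) : ℤ × ℤ) ∈ S
  · exact conclude R hR0'.ne' fun a ha => (row a ha).mpr h1
  · refine conclude (-R) (by omega) fun a ha => ?_
    have h2 : ((-a, R) : ℤ × ℤ) ∉ S := fun h => h1 ((row _ (by omega)).mp h)
    simpa using (hS (-a, R) (by simpa using ha)).resolve_left h2

variable {V : Type*} [AddCommGroup V] [Module ℂ V]

/-- A Heisenberg algebra graded by `ℤ²`, with a conjugate pair in all the degrees `±s` off the
vertical axis, has no non-zero graded module with finite-dimensional components. It is enough to
treat the component of degree `0`, since the grading can be shifted. -/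
theorem eq_bot_of_heisenberg {W : ℤ × ℤ → Submodule ℂ V} (hW : ∀ p, FiniteDimensional ℂ (W p))
    {x : ℤ × ℤ → Module.End ℂ V} (hx : ∀ s p, ∀ v ∈ W p, x s v ∈ W (p + s))
    (hcomm : ∀ s t, s + t ≠ 0 → ∀ v, x s (x t v) = x t (x s v))
    (hpair : ∀ s : ℤ × ℤ, s.1 ≠ 0 →
      ∃ c : ℂ, c ≠ 0 ∧ ∀ v, x s (x (-s) v) - x (-s) (x s v) = c • v) :
    W 0 = ⊥ := by
  by_contra h0
  -- the number operators `x (-s) x s` have a joint eigenvector `v`, with eigenvalues `ν`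
  obtain ⟨v, hvW, hv0, hv⟩ := exists_joint_eigenvector
    (f := fun s : {s : ℤ × ℤ // s.1 ≠ 0} => x (-s.1) * x s.1) (by
      rintro ⟨s, hs⟩ ⟨t, ht⟩ v
      simp only [Module.End.mul_apply]
      rcases eq_or_ne s t with rfl | hst
      · rfl
      rcases eq_or_ne (s + t) 0 with h | h
      · obtain rfl : t = -s := (neg_eq_of_add_eq_zero_right h).symm
        obtain ⟨c, -, hc⟩ := hpair s hs
        have hc' : ∀ v, x s (x (-s) v) = x (-s) (x s v) + c • v := fun v => by
          rw [← hc v]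
          abel
        simp only [neg_neg, hc', map_add, map_smul]
      · have h1 : -s + t ≠ 0 := fun h => hst (neg_add_eq_zero.mp h)
        have h2 : -s + -t ≠ 0 := fun h' => h (by
          rw [← neg_add] at h'
          exact neg_eq_zero.mp h')
        have h3 : s + -t ≠ 0 := fun h' => hst (add_neg_eq_zero.mp h')
        rw [hcomm s (-t) h3, hcomm s t h, hcomm (-s) (-t) h2, hcomm (-s) t h1]) h0
      (by
        rintro ⟨s, hs⟩ v hv
        simpa using hx (-s) _ _ (hx s _ v hv))
  choose ν hν using hv
  simp only [Module.End.mul_apply, Subtype.forall] at hν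
  let S : Set (ℤ × ℤ) := {s | ∃ hs : s.1 ≠ 0, ν ⟨s, hs⟩ ≠ 0}
  have hS : ∀ s : ℤ × ℤ, s.1 ≠ 0 → s ∈ S ∨ -s ∈ S := by
    intro s hs
    by_contra! h
    obtain ⟨c, hc0, hc⟩ := hpair s hs
    have hs' : (-s).1 ≠ 0 := by simpa using hs
    have e1 : ν ⟨s, hs⟩ = 0 := by
      by_contra h'
      exact h.1 ⟨hs, h'⟩
    have e2 : ν ⟨-s, hs'⟩ = 0 := by
      by_contra h'
      exact h.2 ⟨hs', h'⟩
    have h1 := hν s hs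
    have h2 := hν (-s) hs'
    have h3 := hc v
    rw [neg_neg] at h2
    rw [h1, h2, e1, e2, zero_smul, sub_zero, eq_comm, smul_eq_zero] at h3
    tauto
  obtain ⟨r, hr, hinf⟩ := exists_infinite_sum_decompositions hS
  set I := {s : ℤ × ℤ | s.1 ≠ 0 ∧ r.1 - s.1 ≠ 0 ∧ s ∈ S ∧ r - s ∈ S}
  -- one element from each unordered pair `{s, r - s}`
  set J := {s ∈ I | toLex s < toLex (r - s)}
  have hJinf : J.Infinite := by
    intro hJfin
    refine hinf (((hJfin.union (hJfin.image fun s => r - s)).union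
      (Set.Subsingleton.finite (s := {s : ℤ × ℤ | s = r - s}) ?_)).subset fun s hs => ?_)
    · intro s hs t ht
      have h1 : s = r - s := hs
      have h2 : t = r - t := ht
      have h3 := congrArg Prod.fst h1
      have h4 := congrArg Prod.snd h1
      have h5 := congrArg Prod.fst h2
      have h6 := congrArg Prod.snd h2
      simp only [Prod.fst_sub, Prod.snd_sub] at h3 h4 h5 h6
      ext <;> omega
    · rcases lt_trichotomy (toLex s) (toLex (r - s)) with h | h | h
      · exact Or.inl (Or.inl ⟨hs, h⟩)
      · exact Or.inr (toLex.injective h)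
      · refine Or.inl (Or.inr ⟨r - s, ⟨⟨hs.2.1, ?_, hs.2.2.2, ?_⟩, ?_⟩, sub_sub_cancel r s⟩)
        · simpa using hs.1
        · rw [sub_sub_cancel]
          exact hs.2.2.1
        · rw [sub_sub_cancel]
          exact h
  have key : ∀ s t : ℤ × ℤ, s ≠ t → s + t ≠ 0 → ∀ (hs : s.1 ≠ 0),
      x (-s) (x s (x t v)) = ν ⟨s, hs⟩ • x t v := by
    intro s t hst hst' hs
    rw [hcomm s t hst', hcomm (-s) t fun h => hst (neg_add_eq_zero.mp h), hν s hs, map_smul]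
  let w : J → V := fun s => x s.1 (x (r - s.1) v)
  have hne : ∀ s : J, w s ≠ 0 := by
    rintro ⟨s, ⟨hs, hs', ⟨_, hsS⟩, ⟨_, hsS'⟩⟩, hlt⟩ h
    have h1 : s ≠ r - s := fun h => hlt.ne (congrArg toLex h)
    have h2 := key s (r - s) h1 (by simpa using hr) hs
    rw [show x s (x (r - s) v) = 0 from h, map_zero, eq_comm, smul_eq_zero] at h2
    have h3 := hν (r - s) hs'
    rw [h2.resolve_left hsS, map_zero, eq_comm, smul_eq_zero] at h3
    tauto
  -- On `w s` the operator `x (-s) x s` has eigenvalue `ν s - c`; on the other vectors of the family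
  -- it has eigenvalue `ν s` or, if `-s` is one of the two degrees, `ν s + c`.
  have hsep : ∀ s : J, ∃ P : Module.End ℂ V, ∃ a : ℂ, a ≠ 0 ∧ P (w s) = a • w s ∧
      ∀ t, t ≠ s → P (w t) = 0 := by
    rintro ⟨s, ⟨hs, hs', ⟨_, hsS⟩, ⟨_, hsS'⟩⟩, hlt⟩
    obtain ⟨c, hc0, hc⟩ := hpair s hs
    have hc' : ∀ u, x s (x (-s) u) = x (-s) (x s u) + c • u := fun u => by
      rw [← hc u]
      abel
    let M : Module.End ℂ V := x (-s) * x s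
    let n : ℂ := ν ⟨s, hs⟩
    have hM : ∀ u, M u = x (-s) (x s u) := fun u => rfl
    have hself : M (x s (x (r - s) v)) = (n - c) • x s (x (r - s) v) := by
      have h1 : s ≠ r - s := fun h => hlt.ne (congrArg toLex h)
      have h2 := key s (r - s) h1 (by simpa using hr) hs
      have h3 := hc' (x s (x (r - s) v))
      rw [h2, map_smul] at h3
      rw [hM, sub_smul, h3, add_sub_cancel_right]
    have hother : ∀ t ∈ J, t ≠ s →
        (M - n • 1) ((M - (n + c) • 1) (x t (x (r - t) v))) = 0 := by
      rintro t ⟨-, hlt'⟩ hts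
      have hneg : ∀ u, u ≠ s → u ≠ -s → M (x (-s) (x u v)) = (n + c) • x (-s) (x u v) := by
        intro u h1 h2
        have h3 := key s u h1.symm (fun h => h2 (neg_eq_of_add_eq_zero_right h).symm) hs
        rw [hM, hc', map_add, map_smul, h3, map_smul, add_smul]
      have hpos : ∀ y, M y = (n + c) • y → (M - n • 1) ((M - (n + c) • 1) y) = 0 := by
        intro y hy
        simp [hy]
      by_cases h1 : t = -s
      · subst h1
        refine hpos _ (hneg _ (fun h => hr (by simpa using h)) fun h => ?_)
        exact hlt'.ne (congrArg toLex h.symm)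
      have h2 : r - t ≠ s := by
        intro h
        rw [← h, sub_sub_cancel, h] at hlt
        rw [h] at hlt'
        exact lt_asymm hlt hlt'
      by_cases h3 : r - t = -s
      · refine hpos _ ?_
        rw [hcomm t (r - t) (by simpa using hr), h3]
        exact hneg t hts h1
      · have h4 := key s (r - t) h2.symm (fun h => h3 (neg_eq_of_add_eq_zero_right h).symm) hs
        have h5 : M (x t (x (r - t) v)) = n • x t (x (r - t) v) := by
          rw [hM, hcomm s t (fun h => h1 (neg_eq_of_add_eq_zero_right h).symm),
            hcomm (-s) t (fun h => hts (neg_add_eq_zero.mp h).symm), h4, map_smul]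
        simp only [LinearMap.sub_apply, LinearMap.smul_apply, Module.End.one_apply, h5, map_sub,
          map_smul]
        module
    refine ⟨(M - n • 1) * (M - (n + c) • 1), 2 * c ^ 2, by simpa using hc0, ?_, ?_⟩
    · change (M - n • 1) ((M - (n + c) • 1) (x s (x (r - s) v))) = _ • x s (x (r - s) v)
      simp only [LinearMap.sub_apply, LinearMap.smul_apply, Module.End.one_apply, hself, map_sub,
        map_smul]
      module
    · rintro ⟨t, ht⟩ hts
      exact hother t ht fun h => hts (Subtype.ext h)
  have hli : LinearIndependent ℂ w := by
    rw [linearIndependent_iff']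
    intro F g hg s hs
    obtain ⟨P, a, ha, hP, hP'⟩ := hsep s
    have h1 := congrArg P hg
    rw [map_sum, Finset.sum_eq_single s (fun t _ hts => by rw [map_smul, hP' t hts, smul_zero])
      (fun h => absurd hs h), map_smul, hP, map_zero, smul_eq_zero, smul_eq_zero] at h1
    have := hne s
    tauto
  have hwW : ∀ s, w s ∈ W r := fun s => by
    have := hx s.1 _ _ (hx (r - s.1) _ v hvW)
    simpa using this
  have hli' : LinearIndependent ℂ fun s : J => (⟨w s, hwW s⟩ : W r) :=
    LinearIndependent.of_comp (W r).subtype hli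
  have : Finite J := hli'.finite
  exact hJinf (Set.toFinite J)

end Heisenberg

/-! ### The invariant form on the Cartan subalgebra -/

/-- The invariant form is non-zero on the Cartan subalgebra, since a Cartan subalgebra is orthogonal
to the root spaces. -/
lemma InvariantForm.exists_form_self_ne_zero {𝔤 : Type*} [LieRing 𝔤] [LieAlgebra ℂ 𝔤]
    [FiniteDimensional ℂ 𝔤] [LieAlgebra.IsSimple ℂ 𝔤] (Φ : InvariantForm 𝔤)
    (𝔥 : LieSubalgebra ℂ 𝔤) [𝔥.IsCartanSubalgebra] : ∃ X ∈ 𝔥, Φ.form X X ≠ 0 := by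
  have habel : ∀ X ∈ 𝔥, ∀ Y ∈ 𝔥, ⁅X, Y⁆ = 0 := fun X hX Y hY =>
    congrArg Subtype.val (trivial_lie_zero 𝔥 𝔥 ⟨X, hX⟩ ⟨Y, hY⟩)
  by_contra! h
  -- by polarization the form vanishes on `𝔥 × 𝔥`
  have h0 : ∀ X ∈ 𝔥, ∀ Y ∈ 𝔥, Φ.form X Y = 0 := by
    intro X hX Y hY
    have h1 := h (X + Y) (add_mem hX hY)
    rw [map_add, map_add, LinearMap.add_apply, LinearMap.add_apply, h X hX, h Y hY,
      show Φ.form Y X = Φ.form X Y from Φ.symm.eq Y X, zero_add, add_zero] at h1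
    have h2 : (2 : ℂ) * Φ.form X Y = 0 := by rw [two_mul, h1]
    exact (mul_eq_zero.mp h2).resolve_left two_ne_zero
  have h1 : ∀ X ∈ 𝔥, ∀ Y, Φ.form X Y = 0 := by
    intro X hX Y
    have hY : Y ∈ ⨆ α, LieAlgebra.rootSpace 𝔥 α := by
      rw [LieModule.iSup_genWeightSpace_eq_top ℂ 𝔥 𝔤]
      trivial
    induction hY using LieSubmodule.iSup_induction' with
    | mem α Y hY =>
      by_cases hα : α = 0
      · subst hα
        rw [LieAlgebra.rootSpace_zero_eq] at hY
        exact h0 X hX Y hY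
      · obtain ⟨Z, hZ⟩ := Function.ne_iff.mp hα
        have e1 := Φ.invariant Z.1 X Y
        rw [habel _ Z.2 _ hX, map_zero, LinearMap.zero_apply] at e1
        have e2 : ⁅Z.1, Y⁆ = α Z • Y := LieAlgebra.IsKilling.lie_eq_smul_of_mem_rootSpace hY Z
        rw [e2, map_smul, eq_comm, neg_eq_zero, smul_eq_zero] at e1
        exact e1.resolve_left hZ
    | zero => simp
    | add _ _ _ _ h1 h2 => rw [map_add, h1, h2, add_zero]
  have h2 : ∀ X ∈ 𝔥, X = 0 := fun X hX => Φ.nondegenerate.1 X (h1 X hX)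
  -- the Cartan subalgebra is non-zero, because the zero subalgebra is not self-normalizing
  have h3 : (⊤ : LieSubalgebra ℂ 𝔤) = 𝔥 := by
    rw [← LieSubalgebra.IsCartanSubalgebra.self_normalizing (H := 𝔥), eq_comm, eq_top_iff]
    intro X _
    rw [LieSubalgebra.mem_normalizer_iff]
    intro Y hY
    rw [h2 Y hY, lie_zero]
    exact zero_mem 𝔥
  have : Nontrivial 𝔤 := LieAlgebra.IsSimple.nontrivial ℂ 𝔤
  obtain ⟨X, hX⟩ := exists_ne (0 : 𝔤)
  exact hX (h2 X (h3 ▸ LieSubalgebra.mem_top X))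

/-! ### Operators of a given degree on a module over `τ` -/

section Modules

variable {𝔤 : Type*} [LieRing 𝔤] [LieAlgebra ℂ 𝔤] (Φ : InvariantForm 𝔤) {n : ℕ}

/-- The inclusion of `Z` in `τ`, as a linear map. -/
def Tau.zHom : Omega n →ₗ[ℂ] Tau Φ n :=
  (LieAlgebra.SemiDirectSum.inl (degreeAction Φ n)).toLinearMap ∘ₗ
    (toroidalData Φ n).pair.toLinearMap ∘ₗ LinearMap.inr ℂ _ _

lemma Tau.zHom_apply (w : Omega n) : Tau.zHom Φ w = Tau.z Φ w := rfl

lemma Tau.right_add (y y' : Tau Φ n) : (y + y').right = y.right + y'.right := rfl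

lemma Tau.right_smul (a : ℂ) (y : Tau Φ n) : (a • y).right = a • y.right := rfl

lemma Tau.induction {p : Tau Φ n → Prop} (hadd : ∀ y y', p y → p y' → p (y + y'))
    (hx : ∀ r X, p (Tau.x Φ r X)) (hz : ∀ m v, p (Tau.z Φ (omega m v)))
    (hd : ∀ c : Degrees n, p ⟨0, c⟩) (y : Tau Φ n) : p y := by
  have e : y = ⟨y.left, 0⟩ + ⟨0, y.right⟩ := by
    refine LieAlgebra.SemiDirectSum.ext ?_ ?_ <;> simp
  rw [e]
  refine hadd _ _ ?_ (hd _)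
  induction y.left using core_induction with
  | hadd a b ha hb =>
    have e : (⟨a + b, 0⟩ : Tau Φ n) = ⟨a, 0⟩ + ⟨b, 0⟩ :=
      LieAlgebra.SemiDirectSum.ext rfl (add_zero 0).symm
    rw [e]
    exact hadd _ _ ha hb
  | hmono r X => exact hx r X
  | homega m v => exact hz m v

lemma Tau.degrees_lie (c : Degrees n) (a : ToroidalCore Φ n) :
    ⁅(⟨0, c⟩ : Tau Φ n), (⟨a, 0⟩ : Tau Φ n)⁆ = ⟨coreDer Φ n c a, 0⟩ := by
  have e : degreeAction Φ n c a = coreDer Φ n c a := rfl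
  refine LieAlgebra.SemiDirectSum.ext ?_ ?_ <;> simp [e]

/-- The element `∑ i, v_i t^m K_i` is an eigenvector of `τ` of degree `m`. -/
lemma Tau.lie_z (y : Tau Φ n) (m : Fin n → ℤ) (v : Fin n → ℂ) :
    ⁅y, Tau.z Φ (omega m v)⁆ = weight y.right m • Tau.z Φ (omega m v) := by
  have w0 : weight (0 : Degrees n) m = 0 := by rw [map_zero]; rfl
  induction y using Tau.induction with
  | hadd y y' h h' =>
    rw [add_lie, h, h', Tau.right_add, map_add, AddMonoidHom.add_apply,
      add_smul]
  | hx r X =>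
    rw [← lie_skew, Tau.z_lie_x, neg_zero]
    change _ = weight (0 : Degrees n) m • _
    rw [w0, zero_smul]
  | hz m' v' =>
    rw [Tau.z_lie_z]
    change _ = weight (0 : Degrees n) m • _
    rw [w0, zero_smul]
  | hd c =>
    refine (Tau.degrees_lie Φ c _).trans ?_
    rw [coreDer_omega]
    refine LieAlgebra.SemiDirectSum.ext rfl ?_
    change (0 : Degrees n) = weight c m • (0 : Degrees n)
    rw [smul_zero]

lemma Tau.x_zero (r : Fin n → ℤ) : Tau.x Φ r (0 : 𝔤) = 0 := by
  simp only [Tau.x, map_zero, pair_zero_zero]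
  rfl

lemma Tau.degrees_lie_x (c : Degrees n) (r : Fin n → ℤ) (X : 𝔤) :
    ⁅(⟨0, c⟩ : Tau Φ n), Tau.x Φ r X⁆ = weight c r • Tau.x Φ r X := by
  refine (Tau.degrees_lie Φ c _).trans ?_
  rw [coreDer_mono]
  refine LieAlgebra.SemiDirectSum.ext rfl ?_
  change (0 : Degrees n) = weight c r • (0 : Degrees n)
  rw [smul_zero]

/-- An element `X(r)` with `X` centralizing `𝔥` is an eigenvector of the Cartan subalgebra of
`τ`, of degree `r`. -/
lemma Tau.cartan_lie_x {𝔥 : LieSubalgebra ℂ 𝔤} {X : 𝔤} (hX : ∀ Y ∈ 𝔥, ⁅Y, X⁆ = 0)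
    (r : Fin n → ℤ) {y : Tau Φ n} (hy : y ∈ cartan Φ n 𝔥) :
    ⁅y, Tau.x Φ r X⁆ = weight y.right r • Tau.x Φ r X := by
  have w0 : weight (0 : Degrees n) r = 0 := by rw [map_zero]; rfl
  induction hy using Submodule.span_induction with
  | mem y hy =>
    rcases hy with (⟨Y, hY, rfl⟩ | ⟨i, rfl⟩) | ⟨i, rfl⟩
    · change _ = weight (0 : Degrees n) r • _
      rw [Tau.x_lie_x, hX Y hY, w0, zero_smul, Tau.sum_smul_tK_eq_z, Tau.x_zero]
      have e : (fun i => (((0 : Fin n → ℤ) i : ℤ) : ℂ)) = 0 := funext fun i => Int.cast_zero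
      rw [e, ← Tau.zHom_apply, map_zero, map_zero, smul_zero, zero_add]
    · change ⁅Tau.z Φ _, _⁆ = weight (0 : Degrees n) r • _
      rw [Tau.z_lie_x, w0, zero_smul]
    · exact Tau.degrees_lie_x Φ _ r X
  | zero =>
    change _ = weight (0 : Degrees n) r • _
    rw [zero_lie, w0, zero_smul]
  | add y y' _ _ h h' =>
    rw [add_lie, h, h', Tau.right_add, map_add, AddMonoidHom.add_apply,
      add_smul]
  | smul a y _ h =>
    rw [smul_lie, h, Tau.right_smul, map_smul, AddMonoidHom.smul_apply,
      smul_assoc]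

variable {V : Type*} [AddCommGroup V] [Module ℂ V] [LieRingModule (Tau Φ n) V]
  [LieModule ℂ (Tau Φ n) V]

/-- The operator `E` has degree `r`: it commutes with `𝔤 ⊗ A ⊕ Z`, and `[d_i, E] = r_i E`. -/
def IsDegreeOp (r : Fin n → ℤ) (E : V →ₗ[ℂ] V) : Prop :=
  ∀ (y : Tau Φ n) (v : V), ⁅y, E v⁆ = E ⁅y, v⁆ + weight y.right r • E v

/-- The operator `∑ i, v_i t^m K_i`, as a linear function of the coefficients. -/
def centralOp (V : Type*) [AddCommGroup V] [Module ℂ V] [LieRingModule (Tau Φ n) V]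
    [LieModule ℂ (Tau Φ n) V] (m : Fin n → ℤ) : (Fin n → ℂ) →ₗ[ℂ] Module.End ℂ V :=
  LinearMap.mk₂ ℂ (fun c v => ⁅Tau.zHom Φ (omega m c), v⁆)
    (fun _ _ _ => by rw [map_add, map_add, add_lie])
    (fun _ _ _ => by rw [map_smul, map_smul, smul_lie])
    (fun _ _ _ => lie_add _ _ _) (fun _ _ _ => lie_smul _ _ _)

variable {Φ}

lemma centralOp_apply (m : Fin n → ℤ) (c : Fin n → ℂ) (v : V) :
    centralOp Φ V m c v = ⁅Tau.z Φ (omega m c), v⁆ := rfl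

lemma centralOp_self (m : Fin n → ℤ) : centralOp Φ V m (fun i => (m i : ℂ)) = 0 := by
  refine LinearMap.ext fun v => ?_
  rw [centralOp_apply, omega_self, ← Tau.zHom_apply, map_zero, zero_lie, LinearMap.zero_apply]

lemma isDegreeOp_centralOp (m : Fin n → ℤ) (c : Fin n → ℂ) :
    IsDegreeOp Φ m (centralOp Φ V m c) := by
  intro y v
  rw [centralOp_apply, centralOp_apply, leibniz_lie, Tau.lie_z, smul_lie, add_comm]

lemma mem_centralDegrees {m : Fin n → ℤ} {c : Fin n → ℂ} (h : centralOp Φ V m c ≠ 0) :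
    m ∈ centralDegrees Φ n V := by
  refine ⟨m, ?_, Or.inl rfl⟩
  by_contra! h0
  refine h (LinearMap.ext fun v => ?_)
  rw [centralOp_apply, ← Tau.sum_smul_tK_eq_z, sum_lie]
  refine Finset.sum_eq_zero fun i _ => ?_
  rw [smul_lie, h0, smul_zero]

namespace IsDegreeOp

variable {r s : Fin n → ℤ} {E F : V →ₗ[ℂ] V}

lemma lie_x (h : IsDegreeOp Φ r E) (s : Fin n → ℤ) (X : 𝔤) (v : V) :
    ⁅Tau.x Φ s X, E v⁆ = E ⁅Tau.x Φ s X, v⁆ := by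
  have w0 : weight (0 : Degrees n) r = 0 := by rw [map_zero]; rfl
  refine (h _ v).trans ?_
  change _ + weight (0 : Degrees n) r • _ = _
  rw [w0, zero_smul, add_zero]

lemma comm_centralOp (h : IsDegreeOp Φ r E) (m : Fin n → ℤ) (c : Fin n → ℂ) (v : V) :
    centralOp Φ V m c (E v) = E (centralOp Φ V m c v) := by
  have w0 : weight (0 : Degrees n) r = 0 := by rw [map_zero]; rfl
  refine (h _ v).trans ?_
  change _ + weight (0 : Degrees n) r • _ = _
  rw [w0, zero_smul, add_zero]
  rfl

lemma comp (hE : IsDegreeOp Φ r E) (hF : IsDegreeOp Φ s F) : IsDegreeOp Φ (r + s) (E ∘ₗ F) := by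
  intro y v
  rw [LinearMap.comp_apply, LinearMap.comp_apply, hE, hF, map_add, map_smul, map_add, add_smul]
  abel

lemma one : IsDegreeOp Φ (0 : Fin n → ℤ) (LinearMap.id : V →ₗ[ℂ] V) := by
  intro y v
  rw [map_zero, zero_smul, add_zero]
  rfl

lemma symm {e : V ≃ₗ[ℂ] V} (h : IsDegreeOp Φ r e.toLinearMap) :
    IsDegreeOp Φ (-r) e.symm.toLinearMap := by
  intro y v
  obtain ⟨u, rfl⟩ := e.surjective v
  have h1 : ⁅y, e u⁆ = e ⁅y, u⁆ + weight y.right r • e u := h y u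
  apply e.injective
  simp [h1]

lemma sub (hE : IsDegreeOp Φ r E) (hF : IsDegreeOp Φ r F) : IsDegreeOp Φ r (E - F) := by
  intro y v
  rw [LinearMap.sub_apply, LinearMap.sub_apply, lie_sub, hE, hF, smul_sub]
  abel

lemma smul (hE : IsDegreeOp Φ r E) (c : ℂ) : IsDegreeOp Φ r (c • E) := by
  intro y v
  rw [LinearMap.smul_apply, LinearMap.smul_apply, lie_smul, hE, smul_add, smul_comm c]

/-- On an irreducible module a non-zero operator of some degree is invertible, because its kernel
and its range are submodules. -/
lemma bijective [LieModule.IsIrreducible ℂ (Tau Φ n) V] (h : IsDegreeOp Φ r E) (h0 : E ≠ 0) :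
    Function.Bijective E := by
  let K : LieSubmodule ℂ (Tau Φ n) V :=
    { LinearMap.ker E with
      lie_mem := fun {y v} hv => by
        have hv' : E v = 0 := hv
        have h1 := h y v
        rw [hv', lie_zero, smul_zero, add_zero] at h1
        exact h1.symm }
  let R : LieSubmodule ℂ (Tau Φ n) V :=
    { LinearMap.range E with
      lie_mem := fun {y v} hv => by
        obtain ⟨u, rfl⟩ := hv
        exact ⟨⁅y, u⁆ + weight y.right r • u, by rw [map_add, map_smul, h]⟩ }
  have hK : ∀ v, v ∈ K ↔ E v = 0 := fun v => Iff.rfl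
  have hR : ∀ v, v ∈ R ↔ ∃ u, E u = v := fun v => Iff.rfl
  obtain ⟨u, hu⟩ : ∃ u, E u ≠ 0 := by
    by_contra! h1
    exact h0 (LinearMap.ext h1)
  constructor
  · rcases IsSimpleOrder.eq_bot_or_eq_top K with h1 | h1
    · refine (injective_iff_map_eq_zero E).mpr fun v hv => ?_
      have := (hK v).mpr hv
      rwa [h1, LieSubmodule.mem_bot] at this
    · exact absurd ((hK u).mp (h1 ▸ LieSubmodule.mem_top u)) hu
  · rcases IsSimpleOrder.eq_bot_or_eq_top R with h1 | h1
    · have := (hR (E u)).mpr ⟨u, rfl⟩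
      rw [h1, LieSubmodule.mem_bot] at this
      exact absurd this hu
    · exact fun v => (hR v).mp (h1 ▸ LieSubmodule.mem_top v)

end IsDegreeOp

variable (Φ V) in
/-- The degrees of invertible operators that have a degree. -/
def degreeGroup : AddSubgroup (Fin n → ℤ) where
  carrier := {r | ∃ e : V ≃ₗ[ℂ] V, IsDegreeOp Φ r e.toLinearMap}
  zero_mem' := ⟨LinearEquiv.refl ℂ V, IsDegreeOp.one⟩
  add_mem' := by
    rintro r s ⟨e, he⟩ ⟨f, hf⟩
    exact ⟨f.trans e, he.comp hf⟩
  neg_mem' := by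
    rintro r ⟨e, he⟩
    exact ⟨e.symm, he.symm⟩

lemma mem_degreeGroup_of_mem_span [LieModule.IsIrreducible ℂ (Tau Φ n) V] {r : Fin n → ℤ}
    (hr : r ∈ Submodule.span ℤ (centralDegrees Φ n V)) : r ∈ degreeGroup Φ V := by
  have h : Submodule.span ℤ (centralDegrees Φ n V) ≤
      AddSubgroup.toIntSubmodule (degreeGroup Φ V) := by
    rw [Submodule.span_le]
    rintro r ⟨m, ⟨i, v, hv⟩, hr⟩
    have h1 : m ∈ degreeGroup Φ V := by
      refine ⟨LinearEquiv.ofBijective _ ((isDegreeOp_centralOp m (Pi.single i 1)).bijective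
        fun h => hv ?_), isDegreeOp_centralOp m _⟩
      exact LinearMap.congr_fun h v
    rcases hr with rfl | rfl
    · exact h1
    · exact neg_mem h1
  exact h hr

/-! ### Weight spaces -/

variable (Φ) in
/-- The weight of `t^r` with respect to the Cartan subalgebra of `τ`: it vanishes on the `h` and
the `K_i`, and takes the value `r_i` at `d_i`. -/
def degreeWeight (𝔥 : LieSubalgebra ℂ 𝔤) : (Fin n → ℤ) →+ Module.Dual ℂ (cartan Φ n 𝔥) where
  toFun r :=
    { toFun := fun y => weight y.1.right r
      map_add' := fun y y' => by
        change weight (y.1 + y'.1).right r = _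
        rw [Tau.right_add, map_add, AddMonoidHom.add_apply]
      map_smul' := fun a y => by
        change weight (a • y.1).right r = _
        rw [Tau.right_smul, map_smul]
        rfl }
  map_zero' := LinearMap.ext fun y => map_zero (weight y.1.right)
  map_add' r s := LinearMap.ext fun y => map_add (weight y.1.right) r s

variable {𝔥 : LieSubalgebra ℂ 𝔤}

lemma degreeWeight_apply (r : Fin n → ℤ) (y : cartan Φ n 𝔥) :
    degreeWeight Φ 𝔥 r y = weight y.1.right r := rfl

lemma IsDegreeOp.mem_weightSpace {r : Fin n → ℤ} {E : V →ₗ[ℂ] V} (hE : IsDegreeOp Φ r E)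
    {lam : Module.Dual ℂ (cartan Φ n 𝔥)} {v : V} (hv : v ∈ weightSpace Φ n V 𝔥 lam) :
    E v ∈ weightSpace Φ n V 𝔥 (lam + degreeWeight Φ 𝔥 r) := fun h => by
  rw [hE, hv h, map_smul, LinearMap.add_apply, add_smul, degreeWeight_apply]

lemma lie_x_mem_weightSpace {X : 𝔤} (hX : ∀ Y ∈ 𝔥, ⁅Y, X⁆ = 0) (r : Fin n → ℤ)
    {lam : Module.Dual ℂ (cartan Φ n 𝔥)} {v : V} (hv : v ∈ weightSpace Φ n V 𝔥 lam) :
    ⁅Tau.x Φ r X, v⁆ ∈ weightSpace Φ n V 𝔥 (lam + degreeWeight Φ 𝔥 r) := fun h => by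
  rw [leibniz_lie, Tau.cartan_lie_x Φ hX r h.2, hv h, smul_lie, lie_smul, LinearMap.add_apply,
    add_smul, degreeWeight_apply, add_comm]

lemma IsFiniteWeightModule.exists_ne_bot [Nontrivial V] (hV : IsFiniteWeightModule Φ n V 𝔥) :
    ∃ lam : Module.Dual ℂ (cartan Φ n 𝔥), weightSpace Φ n V 𝔥 lam ≠ ⊥ := by
  by_contra! h
  have := hV.iSup_eq_top
  simp only [h, iSup_bot] at this
  exact bot_ne_top this

/-- Schur's lemma: an operator of degree `0` has an eigenvalue on a weight space, hence is a
scalar. -/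
lemma IsDegreeOp.exists_eq_smul [LieModule.IsIrreducible ℂ (Tau Φ n) V] [Nontrivial V]
    (hV : IsFiniteWeightModule Φ n V 𝔥) {E : V →ₗ[ℂ] V} (hE : IsDegreeOp Φ (0 : Fin n → ℤ) E) :
    ∃ c : ℂ, E = c • LinearMap.id := by
  obtain ⟨lam, hlam⟩ := hV.exists_ne_bot
  have := hV.finiteDimensional lam
  have hW : ∀ v ∈ weightSpace Φ n V 𝔥 lam, E v ∈ weightSpace Φ n V 𝔥 lam := fun v hv => by
    have := hE.mem_weightSpace hv
    rwa [map_zero, add_zero] at this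
  obtain ⟨v, -, hv0, hv⟩ := exists_joint_eigenvector (f := fun _ : Unit => E)
    (fun _ _ _ => rfl) hlam fun _ => hW
  obtain ⟨c, hc⟩ := hv ()
  refine ⟨c, sub_eq_zero.mp ?_⟩
  by_contra h
  refine hv0 (((hE.sub (IsDegreeOp.one.smul c)).bijective h).1 ?_)
  simp [hc]

lemma lie_x_comm {X : 𝔤} (r s : Fin n → ℤ) (v : V) :
    ⁅Tau.x Φ r X, ⁅Tau.x Φ s X, v⁆⁆ = ⁅Tau.x Φ s X, ⁅Tau.x Φ r X, v⁆⁆ +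
      Φ.form X X • centralOp Φ V (r + s) (fun i => (r i : ℂ)) v := by
  rw [leibniz_lie, Tau.x_lie_x, lie_self, Tau.x_zero, zero_add, Tau.sum_smul_tK_eq_z, smul_lie,
    add_comm, centralOp_apply]

end Modules

/-! ### The rank of the central degrees -/

section Rank

variable {𝔤 : Type*} [LieRing 𝔤] [LieAlgebra ℂ 𝔤] {Φ : InvariantForm 𝔤} {n : ℕ}
  {V : Type*} [AddCommGroup V] [Module ℂ V] [LieRingModule (Tau Φ n) V]
  [LieModule ℂ (Tau Φ n) V] [LieModule.IsIrreducible ℂ (Tau Φ n) V] [Nontrivial V]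
  {𝔥 : LieSubalgebra ℂ 𝔤}

/-- The operator `∑ i, r_i t^m K_i` vanishes if `r` is in the span of the central degrees. Otherwise
invertible operators of degrees `m` and `r` move `X(r)` and `X(m - r)` to degree `0`, where their
commutator is a non-zero scalar. -/
lemma centralOp_eq_zero_of_mem_span (hV : IsFiniteWeightModule Φ n V 𝔥) {X : 𝔤}
    (hX : ∀ Y ∈ 𝔥, ⁅Y, X⁆ = 0) (hXX : Φ.form X X ≠ 0) {r : Fin n → ℤ}
    (hr : r ∈ Submodule.span ℤ (centralDegrees Φ n V)) (m : Fin n → ℤ) :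
    centralOp Φ V m (fun i => (r i : ℂ)) = 0 := by
  by_contra h0
  obtain ⟨e, he⟩ := mem_degreeGroup_of_mem_span hr
  have hz := isDegreeOp_centralOp (Φ := Φ) (V := V) m fun i => (r i : ℂ)
  let z : V ≃ₗ[ℂ] V := LinearEquiv.ofBijective _ (hz.bijective h0)
  have hzapp : ∀ v, z v = centralOp Φ V m (fun i => (r i : ℂ)) v := fun v => rfl
  have hz' : IsDegreeOp Φ m z.toLinearMap := hz
  have hze : ∀ v, z.symm (e v) = e (z.symm v) := by
    intro v
    apply z.injective
    rw [LinearEquiv.apply_symm_apply, hzapp]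
    refine ((he.comm_centralOp m _ _).trans (congrArg e ?_)).symm
    rw [← hzapp, LinearEquiv.apply_symm_apply]
  obtain ⟨lam, hlam⟩ := hV.exists_ne_bot
  have := hV.finiteDimensional lam
  let A : Module.End ℂ V := e.symm.toLinearMap ∘ₗ LieModule.toEnd ℂ (Tau Φ n) V (Tau.x Φ r X)
  let B : Module.End ℂ V := z.symm.toLinearMap ∘ₗ e.toLinearMap ∘ₗ
    LieModule.toEnd ℂ (Tau Φ n) V (Tau.x Φ (m - r) X)
  refine hXX (eq_zero_of_commutator_eq_smul hlam (A := A) (B := B) ?_ ?_ ?_)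
  · intro v hv
    have h1 := he.symm.mem_weightSpace (lie_x_mem_weightSpace hX r hv)
    rwa [add_assoc, ← map_add, add_neg_cancel, map_zero, add_zero] at h1
  · intro v hv
    have h1 := hz'.symm.mem_weightSpace
      (he.mem_weightSpace (lie_x_mem_weightSpace hX (m - r) hv))
    rwa [add_assoc, add_assoc, ← map_add, ← map_add, ← add_assoc, sub_add_cancel, add_neg_cancel,
      map_zero, add_zero] at h1
  · intro v
    have hA : ∀ v, A v = e.symm ⁅Tau.x Φ r X, v⁆ := fun v => rfl
    have hB : ∀ v, B v = z.symm (e ⁅Tau.x Φ (m - r) X, v⁆) := fun v => rfl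
    have h1 : ∀ v, ⁅Tau.x Φ r X, z.symm v⁆ = z.symm ⁅Tau.x Φ r X, v⁆ := hz'.symm.lie_x r X
    have h2 : ∀ v, ⁅Tau.x Φ r X, e v⁆ = e ⁅Tau.x Φ r X, v⁆ := he.lie_x r X
    have h3 : ∀ v, ⁅Tau.x Φ (m - r) X, e.symm v⁆ = e.symm ⁅Tau.x Φ (m - r) X, v⁆ :=
      he.symm.lie_x (m - r) X
    rw [hA, hB, hA, hB, h1, h2, h3, hze, LinearEquiv.symm_apply_apply,
      LinearEquiv.apply_symm_apply, ← map_sub, lie_x_comm, add_sub_cancel, ← hzapp,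
      add_sub_cancel_left, map_smul, LinearEquiv.symm_apply_apply]

/-- There is no plane spanned by `u` and `w` which is independent of the central degrees and in
which the operators `∑ i, r_i t^m K_i`, for a fixed `m`, are non-zero off a line: the elements
`X(a u + b w)` and their conjugates `X(m - a u - b w)`, the latter moved by an invertible operator
of degree `m`, would generate a Heisenberg algebra graded by `ℤ²`. -/
lemma false_of_independent_plane (hV : IsFiniteWeightModule Φ n V 𝔥) {X : 𝔤}
    (hX : ∀ Y ∈ 𝔥, ⁅Y, X⁆ = 0) (hXX : Φ.form X X ≠ 0) {m : Fin n → ℤ}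
    (hm : m ∈ Submodule.span ℤ (centralDegrees Φ n V)) {T : V ≃ₗ[ℂ] V}
    (hT : IsDegreeOp Φ m T.toLinearMap) {u w : Fin n → ℤ}
    (hind : ∀ a b : ℤ, a • u + b • w ∈ Submodule.span ℤ (centralDegrees Φ n V) → a = 0 ∧ b = 0)
    (hne : ∀ a b : ℤ, a ≠ 0 → ∃ c : ℂ, c ≠ 0 ∧
      centralOp Φ V m (fun i => ((a • u + b • w) i : ℂ)) = c • T.toLinearMap) : False := by
  set Γ := Submodule.span ℤ (centralDegrees Φ n V)
  obtain ⟨lam, hlam⟩ := hV.exists_ne_bot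
  let φ : ℤ × ℤ → Fin n → ℤ := fun s => s.1 • u + s.2 • w
  have hφadd : ∀ s t, φ (s + t) = φ s + φ t := fun s t => by
    simp only [φ, Prod.fst_add, Prod.snd_add, add_smul]
    abel
  have hφneg : ∀ s, φ (-s) = -φ s := fun s => by
    simp only [φ, Prod.fst_neg, Prod.snd_neg, neg_smul]
    abel
  let k : ℤ × ℤ → V ≃ₗ[ℂ] V := fun s => if 0 < s.1 then LinearEquiv.refl ℂ V else T.symm
  let g : ℤ × ℤ → Fin n → ℤ := fun s => if 0 < s.1 then φ s else m + φ s
  let x : ℤ × ℤ → Module.End ℂ V := fun s => if s.1 = 0 then 0 else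
    (k s).toLinearMap ∘ₗ LieModule.toEnd ℂ (Tau Φ n) V (Tau.x Φ (g s) X)
  have hx0 : ∀ s v, s.1 = 0 → x s v = 0 := fun s v hs => by simp [x, hs]
  have hx1 : ∀ s v, s.1 ≠ 0 → x s v = k s ⁅Tau.x Φ (g s) X, v⁆ := fun s v hs => by simp [x, hs]
  have hk : ∀ s, IsDegreeOp Φ (φ s - g s) (k s).toLinearMap := by
    intro s
    by_cases hs : 0 < s.1
    · simp only [k, g, hs, if_true, sub_self]
      exact IsDegreeOp.one
    · simp only [k, g, hs, if_false, sub_add_cancel_right]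
      exact hT.symm
  have hkx : ∀ s r v, ⁅Tau.x Φ r X, k s v⁆ = k s ⁅Tau.x Φ r X, v⁆ := fun s r v =>
    (hk s).lie_x r X v
  have hkk : ∀ s t v, k s (k t v) = k t (k s v) := by
    intro s t v
    by_cases hs : 0 < s.1 <;> by_cases ht : 0 < t.1 <;> simp [k, hs, ht]
  have hgΓ : ∀ s, g s - φ s ∈ Γ := by
    intro s
    by_cases hs : 0 < s.1
    · simp [g, hs]
    · simpa [g, hs] using hm
  have hbr : ∀ s t, s.1 ≠ 0 → t.1 ≠ 0 → ∀ v, x s (x t v) - x t (x s v) =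
      Φ.form X X • k s (k t (centralOp Φ V (g s + g t) (fun i => (g s i : ℂ)) v)) := by
    intro s t hs ht v
    rw [hx1 s _ hs, hx1 t _ ht, hx1 t _ ht, hx1 s _ hs, hkx, hkx, hkk t s, ← map_sub, ← map_sub,
      lie_x_comm, add_sub_cancel_left, map_smul, map_smul]
  refine hlam ?_
  have hbot := eq_bot_of_heisenberg
    (W := fun p => weightSpace Φ n V 𝔥 (lam + degreeWeight Φ 𝔥 (φ p)))
    (fun p => hV.finiteDimensional _) (x := x) ?_ ?_ ?_
  · have h1 : φ 0 = 0 := by simp [φ]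
    simpa only [h1, map_zero, add_zero] using hbot
  · intro s p v hv
    by_cases hs : s.1 = 0
    · rw [hx0 s v hs]
      exact zero_mem _
    · rw [hx1 s v hs]
      have h1 := (hk s).mem_weightSpace (lie_x_mem_weightSpace hX (g s) hv)
      rwa [add_assoc, add_assoc, ← map_add, ← map_add, add_sub_cancel, ← hφadd] at h1
  · intro s t hst v
    by_cases hs : s.1 = 0
    · rw [hx0 s _ hs, hx0 s _ hs, map_zero]
    by_cases ht : t.1 = 0
    · rw [hx0 t _ ht, hx0 t _ ht, map_zero]
    have h1 : centralOp Φ V (g s + g t) (fun i => (g s i : ℂ)) = 0 := by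
      by_contra h
      have h2 : g s + g t ∈ Γ := Submodule.subset_span (mem_centralDegrees h)
      have h3 : φ (s + t) ∈ Γ := by
        have h4 := sub_mem h2 (add_mem (hgΓ s) (hgΓ t))
        have h5 : g s + g t - (g s - φ s + (g t - φ t)) = φ (s + t) := by
          rw [hφadd]
          abel
        rwa [h5] at h4
      obtain ⟨h4, h5⟩ := hind _ _ h3
      exact hst (Prod.ext h4 h5)
    have h2 := hbr s t hs ht v
    rw [h1, LinearMap.zero_apply, map_zero, map_zero, smul_zero] at h2
    exact sub_eq_zero.mp h2
  · intro s hs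
    obtain ⟨c, hc, hcT⟩ := hne s.1 s.2 hs
    have hs' : (-s).1 ≠ 0 := by simpa using hs
    refine ⟨Φ.form X X * c, mul_ne_zero hXX hc, fun v => ?_⟩
    have h1 : g s + g (-s) = m := by
      rcases lt_or_gt_of_ne hs with h | h
      · have h2 : ¬ 0 < s.1 := not_lt.mpr h.le
        simp [g, h, h2, hφneg]
      · have h2 : ¬ s.1 < 0 := not_lt.mpr h.le
        simp [g, h, h2, hφneg]
    have h2 : centralOp Φ V m (fun i => (g s i : ℂ)) = c • T.toLinearMap := by
      rw [← hcT]
      by_cases h : 0 < s.1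
      · simp only [g, h, if_true]
        rfl
      · have e : (fun i => (g s i : ℂ)) = (fun i => (m i : ℂ)) + fun i => (φ s i : ℂ) := by
          ext i
          simp [g, h]
        rw [e, map_add, centralOp_self, zero_add]
    have h3 : ∀ v, k s (k (-s) (T v)) = v := by
      intro v
      rcases lt_or_gt_of_ne hs with h | h
      · have h2 : ¬ 0 < s.1 := not_lt.mpr h.le
        simp [k, h, h2]
      · have h2 : ¬ s.1 < 0 := not_lt.mpr h.le
        simp [k, h, h2]
    rw [hbr s (-s) hs hs', h1, h2, LinearMap.smul_apply, map_smul, map_smul, smul_smul]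
    exact congrArg _ (h3 v)

/-- The operator `∑ i, r_i t^m K_i`, as an additive function of `r ∈ ℤⁿ`. -/
def centralOpInt (Φ : InvariantForm 𝔤) (V : Type*) [AddCommGroup V] [Module ℂ V]
    [LieRingModule (Tau Φ n) V] [LieModule ℂ (Tau Φ n) V] (m : Fin n → ℤ) :
    (Fin n → ℤ) →ₗ[ℤ] Module.End ℂ V :=
  ((centralOp Φ V m).toAddMonoidHom.comp ((Int.castAddHom ℂ).compLeft (Fin n))).toIntLinearMap

lemma centralOpInt_apply (m r : Fin n → ℤ) :
    centralOpInt Φ V m r = centralOp Φ V m (fun i => (r i : ℂ)) := rfl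

lemma centralOp_eq_zero_of_basis {ι : Type*} (b : Module.Basis ι ℤ (Fin n → ℤ)) {m : Fin n → ℤ}
    (h : ∀ i, centralOpInt Φ V m (b i) = 0) : centralOp Φ V m = 0 := by
  have h0 : centralOpInt Φ V m = 0 := b.ext h
  refine LinearMap.pi_ext' fun j => LinearMap.ext_ring ?_
  have h1 : centralOp Φ V m (fun i => ((Pi.single j 1 : Fin n → ℤ) i : ℂ)) = 0 :=
    LinearMap.congr_fun h0 (Pi.single j 1)
  have e : (fun i => ((Pi.single j 1 : Fin n → ℤ) i : ℂ)) = Pi.single j 1 := by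
    ext i
    rcases eq_or_ne i j with rfl | hij <;> simp [*]
  rw [e] at h1
  exact h1

/-- If the center acts non-trivially, the central degrees span a sublattice of corank one, and for
some basis of `ℤⁿ` this sublattice lies in the span of all but one of the basis vectors, on which
all the maps `r ↦ ∑ i, r_i t^m K_i` vanish. The basis comes from the Smith normal form. -/
theorem exists_adapted_basis (hV : IsFiniteWeightModule Φ n V 𝔥) {X : 𝔤}
    (hX : ∀ Y ∈ 𝔥, ⁅Y, X⁆ = 0) (hXX : Φ.form X X ≠ 0) (h0 : ∃ m : Fin n → ℤ, centralOp Φ V m ≠ 0) :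
    centralRank Φ n V + 1 = n ∧ ∃ (b : Module.Basis (Fin n) ℤ (Fin n → ℤ)) (i₀ : Fin n),
      (∀ r ∈ Submodule.span ℤ (centralDegrees Φ n V), b.repr r i₀ = 0) ∧
      ∀ m i, i ≠ i₀ → centralOpInt Φ V m (b i) = 0 := by
  set Γ := Submodule.span ℤ (centralDegrees Φ n V)
  obtain ⟨k, S⟩ := Γ.smithNormalForm (Pi.basisFun ℤ (Fin n))
  have hrank : centralRank Φ n V = k := by
    rw [centralRank, Module.finrank_eq_card_basis S.bN, Fintype.card_fin]
  have hΓ0 : ∀ r ∈ Γ, ∀ m, centralOpInt Φ V m r = 0 := fun r hr m =>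
    centralOp_eq_zero_of_mem_span hV hX hXX hr m
  have hrange : ∀ i ∈ Set.range S.f, ∀ m, centralOpInt Φ V m (S.bM i) = 0 := by
    rintro _ ⟨j, rfl⟩ m
    have h1 := hΓ0 _ (S.bN j).2 m
    have h2 : S.a j ≠ 0 := by
      intro h
      have h3 := S.snf j
      rw [h, zero_smul] at h3
      exact S.bN.ne_zero j (Subtype.ext h3)
    rw [S.snf, map_smul, ← Int.cast_smul_eq_zsmul ℂ, smul_eq_zero, Int.cast_eq_zero] at h1
    exact h1.resolve_left h2
  have hrepr : ∀ r ∈ Γ, ∀ i ∉ Set.range S.f, S.bM.repr r i = 0 := fun r hr i hi =>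
    S.repr_eq_zero_of_notMem_range ⟨r, hr⟩ hi
  obtain ⟨m, hm⟩ := h0
  obtain ⟨i₀, hi₀⟩ : ∃ i, centralOpInt Φ V m (S.bM i) ≠ 0 := by
    by_contra! h
    exact hm (centralOp_eq_zero_of_basis S.bM h)
  have hi₀r : i₀ ∉ Set.range S.f := fun h => hi₀ (hrange _ h m)
  -- a second index outside the range would give a plane independent of `Γ`
  have huniq : ∀ i, i ≠ i₀ → i ∈ Set.range S.f := by
    intro i₁ hi₁
    by_contra hi₁r
    have hmΓ : m ∈ Γ := Submodule.subset_span (mem_centralDegrees hi₀)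
    have hdeg := isDegreeOp_centralOp (Φ := Φ) (V := V) m fun i => (S.bM i₀ i : ℂ)
    let T : V ≃ₗ[ℂ] V := LinearEquiv.ofBijective _ (hdeg.bijective hi₀)
    have hT : IsDegreeOp Φ m T.toLinearMap := hdeg
    have hTu : centralOpInt Φ V m (S.bM i₀) = T.toLinearMap := rfl
    obtain ⟨q, hq⟩ : ∃ q : ℂ, centralOpInt Φ V m (S.bM i₁) = q • T.toLinearMap := by
      have h1 := (isDegreeOp_centralOp (Φ := Φ) (V := V) m fun i => (S.bM i₁ i : ℂ)).comp hT.symm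
      rw [add_neg_cancel] at h1
      obtain ⟨q, hq⟩ := h1.exists_eq_smul hV
      refine ⟨q, LinearMap.ext fun v => ?_⟩
      have h2 := LinearMap.congr_fun hq (T v)
      simpa [centralOpInt_apply] using h2
    have hlin : ∀ a b : ℤ, centralOpInt Φ V m (a • S.bM i₀ + b • S.bM i₁) =
        (a + b * q : ℂ) • T.toLinearMap := by
      intro a b
      rw [map_add, map_smul, map_smul, hTu, hq, ← Int.cast_smul_eq_zsmul ℂ,
        ← Int.cast_smul_eq_zsmul ℂ b, smul_smul, add_smul]
    have hcoord : ∀ a b : ℤ, a • S.bM i₀ + b • S.bM i₁ ∈ Γ → a = 0 ∧ b = 0 := by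
      intro a b hab
      have h1 := hrepr _ hab i₀ hi₀r
      have h2 := hrepr _ hab i₁ hi₁r
      rw [map_add, map_smul, map_smul, Finsupp.add_apply, Finsupp.smul_apply, Finsupp.smul_apply,
        Module.Basis.repr_self_apply, Module.Basis.repr_self_apply] at h1 h2
      rw [if_pos rfl, if_neg hi₁, smul_zero, add_zero, smul_eq_mul, mul_one] at h1
      rw [if_pos rfl, if_neg hi₁.symm, smul_zero, zero_add, smul_eq_mul, mul_one] at h2
      exact ⟨h1, h2⟩
    -- If `q` is rational, the kernel of the map meets the plane in a line, spanned by `w`.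
    by_cases hrat : ∃ a b : ℤ, b ≠ 0 ∧ (a + b * q : ℂ) = 0
    · obtain ⟨a', b', hb', hq'⟩ := hrat
      refine false_of_independent_plane hV hX hXX hmΓ hT (u := S.bM i₀)
        (w := a' • S.bM i₀ + b' • S.bM i₁) (fun a b hab => ?_) fun a b ha => ?_
      · have e : a • S.bM i₀ + b • (a' • S.bM i₀ + b' • S.bM i₁) =
            (a + b * a') • S.bM i₀ + (b * b') • S.bM i₁ := by module
        rw [e] at hab
        obtain ⟨h1, h2⟩ := hcoord _ _ hab
        have h3 : b = 0 := (mul_eq_zero.mp h2).resolve_right hb'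
        subst h3
        simpa using h1
      · refine ⟨a, Int.cast_ne_zero.mpr ha, ?_⟩
        rw [← centralOpInt_apply, map_add, map_smul, map_smul, hlin, hq', zero_smul, smul_zero,
          add_zero, hTu, Int.cast_smul_eq_zsmul]
    · push Not at hrat
      refine false_of_independent_plane hV hX hXX hmΓ hT hcoord fun a b ha =>
        ⟨a + b * q, ?_, hlin a b⟩
      by_cases hb : b = 0
      · simpa [hb] using ha
      · exact hrat a b hb
  refine ⟨?_, S.bM, i₀, fun r hr => hrepr r hr i₀ hi₀r, fun m i hi => hrange i (huniq i hi) m⟩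
  have h1 : Finset.univ.map S.f = Finset.univ.erase i₀ := by
    ext i
    simp only [Finset.mem_map, Finset.mem_univ, true_and, Finset.mem_erase, and_true]
    exact ⟨fun h hi => hi₀r (hi ▸ h), huniq i⟩
  have h2 := congrArg Finset.card h1
  rw [Finset.card_map, Finset.card_erase_of_mem (Finset.mem_univ _), Finset.card_univ,
    Finset.card_univ, Fintype.card_fin, Fintype.card_fin] at h2
  have := i₀.pos
  omega

end Rank

/-! ### Factoring a module through `φ` -/

section Factor

variable {𝔤 : Type*} [LieRing 𝔤] [LieAlgebra ℂ 𝔤] (Φ : InvariantForm 𝔤) (N : ℕ)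

/-- The linear section of `corePhi` with `(X ⊗ t_{N+1}^k) ⊗ t^r ↦ X ⊗ t^(r, k)` and
`K ⊗ t^r ↦ t^(r, 0) K_{N+1}`. -/
def corePhiSection : Loop (Fin N → ℤ) (Affine Φ) →ₗ[ℂ] ToroidalCore Φ (N + 1) :=
  loopLift fun r => ((loopLift fun k => (toroidalData Φ (N + 1)).pair.toLinearMap ∘ₗ
    LinearMap.inl ℂ _ _ ∘ₗ mono (Fin.snoc r k : Fin (N + 1) → ℤ)).coprod
      (LinearMap.toSpanSingleton ℂ _ ((toroidalData Φ (N + 1)).pair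
        (0, omega (Fin.snoc r 0 : Fin (N + 1) → ℤ) (Pi.single (Fin.last N) 1))))) ∘ₗ
    (affineData Φ).pair.symm.toLinearMap

lemma corePhiSection_mono (r : Fin N → ℤ) (k : ℤ) (X : 𝔤) :
    corePhiSection Φ N (mono r ((affineData Φ).pair (mono k X, 0))) =
      (toroidalData Φ (N + 1)).pair (mono (Fin.snoc r k : Fin (N + 1) → ℤ) X, 0) := by
  simp [corePhiSection]

lemma corePhiSection_central (r : Fin N → ℤ) (c : ℂ) :
    corePhiSection Φ N (mono r ((affineData Φ).pair (0, c))) =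
      c • (toroidalData Φ (N + 1)).pair
        (0, omega (Fin.snoc r 0 : Fin (N + 1) → ℤ) (Pi.single (Fin.last N) 1)) := by
  simp [corePhiSection]

lemma corePhi_corePhiSection (a : Loop (Fin N → ℤ) (Affine Φ)) :
    corePhi Φ N (corePhiSection Φ N a) = a := by
  induction a using affineCore_induction with
  | hadd a b ha hb => rw [map_add, map_add, ha, hb]
  | hmono r k X =>
    rw [corePhiSection_mono, corePhi_mono]
    simp
  | hcentral r c =>
    rw [corePhiSection_central, map_smul, corePhi_omega]
    simp [← map_smul]

/-- The linear section of `φ` which is the identity on `D`. -/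
def phiSection : AffTau Φ N →ₗ[ℂ] Tau Φ (N + 1) where
  toFun y := ⟨corePhiSection Φ N y.left, y.right⟩
  map_add' y y' := LieAlgebra.SemiDirectSum.ext (map_add (corePhiSection Φ N) y.left y'.left) rfl
  map_smul' a y := LieAlgebra.SemiDirectSum.ext (map_smul (corePhiSection Φ N) a y.left) rfl

lemma phi_phiSection (y : AffTau Φ N) : phi Φ N (phiSection Φ N y) = y :=
  LieAlgebra.SemiDirectSum.ext (corePhi_corePhiSection Φ N y.left) rfl

lemma phiSection_phi_x (r : Fin (N + 1) → ℤ) (X : 𝔤) :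
    phiSection Φ N (phi Φ N (Tau.x Φ r X)) = Tau.x Φ r X := by
  rw [phi_x]
  refine LieAlgebra.SemiDirectSum.ext ((corePhiSection_mono Φ N _ _ X).trans ?_) rfl
  have e : (Fin.snoc (fun j : Fin N => r j.castSucc) (r (Fin.last N)) : Fin (N + 1) → ℤ) = r :=
    Fin.snoc_init_self r
  rw [e]
  rfl

lemma phiSection_phi_tK {m : Fin (N + 1) → ℤ} (hm : m (Fin.last N) = 0) :
    phiSection Φ N (phi Φ N (Tau.tK Φ m (Fin.last N))) = Tau.tK Φ m (Fin.last N) := by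
  rw [phi_tK, if_pos ⟨rfl, hm⟩]
  refine LieAlgebra.SemiDirectSum.ext ((corePhiSection_central Φ N _ 1).trans ?_) rfl
  have e : (Fin.snoc (fun j : Fin N => m j.castSucc) 0 : Fin (N + 1) → ℤ) = m := by
    rw [← hm]
    exact Fin.snoc_init_self m
  rw [e, one_smul]
  rfl

/-- A homomorphism of `τ` to itself, followed by a module on which the image of `ker φ` vanishes,
comes from a module over `𝔤_aff ⊗ A_N ⊕ D`: the kernel is spanned by the `t^m K_i` with
`i ≠ N + 1` or `m_{N+1} ≠ 0`. -/
theorem exists_module_of_central_eq_zero (V : Type*) [AddCommGroup V] [Module ℂ V]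
    [LieRingModule (Tau Φ (N + 1)) V] [LieModule ℂ (Tau Φ (N + 1)) V]
    (f : Tau Φ (N + 1) →ₗ⁅ℂ⁆ Tau Φ (N + 1))
    (hf : ∀ (m : Fin (N + 1) → ℤ) (i : Fin (N + 1)), i ≠ Fin.last N ∨ m (Fin.last N) ≠ 0 →
      ∀ v : V, ⁅f (Tau.tK Φ m i), v⁆ = 0) :
    ∃ (_ : LieRingModule (AffTau Φ N) V) (_ : LieModule ℂ (AffTau Φ N) V),
      ∀ (y : Tau Φ (N + 1)) (v : V), ⁅phi Φ N y, v⁆ = ⁅f y, v⁆ := by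
  have key : ∀ y (v : V), ⁅f (phiSection Φ N (phi Φ N y)), v⁆ = ⁅f y, v⁆ := by
    intro y v
    induction y using Tau.induction with
    | hadd y y' h h' => rw [map_add, map_add, map_add, map_add, add_lie, add_lie, h, h']
    | hx r X => rw [phiSection_phi_x]
    | hz m c =>
      rw [← Tau.sum_smul_tK_eq_z]
      simp only [map_sum, map_smul, sum_lie, smul_lie]
      refine Finset.sum_congr rfl fun i _ => congrArg _ ?_
      by_cases h : i = Fin.last N ∧ m (Fin.last N) = 0
      · obtain ⟨rfl, hm⟩ := h
        rw [phiSection_phi_tK Φ N hm]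
      · rw [phi_tK, if_neg h, map_zero, map_zero, zero_lie, hf m i (by tauto)]
    | hd c =>
      have e : phiSection Φ N (phi Φ N ⟨0, c⟩) = ⟨0, c⟩ := by
        refine LieAlgebra.SemiDirectSum.ext ?_ rfl
        change corePhiSection Φ N (corePhi Φ N 0) = 0
        rw [map_zero, map_zero]
      rw [e]
  let inst : LieRingModule (AffTau Φ N) V :=
    { bracket := fun y v => ⁅f (phiSection Φ N y), v⁆
      add_lie := fun y y' v => by
        change ⁅f (phiSection Φ N (y + y')), v⁆ = _
        rw [map_add, map_add, add_lie]
      lie_add := fun y v v' => lie_add _ v v'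
      leibniz_lie := fun y y' v => by
        change ⁅f (phiSection Φ N y), ⁅f (phiSection Φ N y'), v⁆⁆ =
          ⁅f (phiSection Φ N ⁅y, y'⁆), v⁆ + ⁅f (phiSection Φ N y'), ⁅f (phiSection Φ N y), v⁆⁆
        have e : ⁅y, y'⁆ = phi Φ N ⁅phiSection Φ N y, phiSection Φ N y'⁆ := by
          rw [LieHom.map_lie, phi_phiSection, phi_phiSection]
        rw [e, key, LieHom.map_lie, leibniz_lie] }
  refine ⟨inst, ⟨fun a y v => ?_, fun a y v => lie_smul a (f (phiSection Φ N y)) v⟩, key⟩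
  change ⁅f (phiSection Φ N (a • y)), v⁆ = a • ⁅f (phiSection Φ N y), v⁆
  rw [map_smul, map_smul, smul_lie]

end Factor

/-! ### The change of coordinates -/

/-- The matrix whose columns are the vectors of a basis of `ℤⁿ`. -/
def basisGL {n : ℕ} (b : Module.Basis (Fin n) ℤ (Fin n → ℤ)) :
    Matrix.GeneralLinearGroup (Fin n) ℤ :=
  ⟨(Pi.basisFun ℤ (Fin n)).toMatrix b, b.toMatrix (Pi.basisFun ℤ (Fin n)),
    Module.Basis.toMatrix_mul_toMatrix_flip _ _, Module.Basis.toMatrix_mul_toMatrix_flip _ _⟩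

lemma basisGL_apply {n : ℕ} (b : Module.Basis (Fin n) ℤ (Fin n → ℤ)) (i j : Fin n) :
    (basisGL b).1 i j = b j i := by
  simp [basisGL, Module.Basis.toMatrix_apply]

lemma repr_basisGL_mulVec {n : ℕ} (b : Module.Basis (Fin n) ℤ (Fin n → ℤ)) (m : Fin n → ℤ)
    (i : Fin n) : b.repr ((basisGL b).1.mulVec m) i = m i := by
  have h := b.toMatrix_mulVec_repr (Pi.basisFun ℤ (Fin n)) (b.equivFun.symm m)
  have e : (b.repr (b.equivFun.symm m) : Fin n → ℤ) = m := b.equivFun.apply_symm_apply m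
  rw [e] at h
  have h' : (basisGL b).1.mulVec m = b.equivFun.symm m := by
    refine h.trans ?_
    ext j
    simp
  rw [h']
  exact congrFun e i

lemma tauGL_basisGL_tK {𝔤 : Type*} [LieRing 𝔤] [LieAlgebra ℂ 𝔤] (Φ : InvariantForm 𝔤) {n : ℕ}
    (b : Module.Basis (Fin n) ℤ (Fin n → ℤ)) (m : Fin n → ℤ) (i : Fin n) :
    tauGL Φ n (basisGL b) (Tau.tK Φ m i) =
      Tau.z Φ (omega ((basisGL b).1.mulVec m) fun j => (b i j : ℂ)) := by
  refine LieAlgebra.SemiDirectSum.ext ?_ (map_zero (degreesGL n (basisGL b)))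
  refine (coreGL_omega Φ n (basisGL b) _ _).trans ?_
  have e : ((basisGL b).1.map (Int.cast : ℤ → ℂ)).mulVec (Pi.single i 1) =
      fun j => (b i j : ℂ) := by
    ext j
    rw [Matrix.mulVec_single_one, Matrix.col_apply, Matrix.map_apply, basisGL_apply]
  rw [e]
  rfl

end Toroidal

end

theorem mainTheorem1 (N : ℕ) (hN : 1 ≤ N)
    {𝔤 : Type*} [LieRing 𝔤] [LieAlgebra ℂ 𝔤] [FiniteDimensional ℂ 𝔤] [LieAlgebra.IsSimple ℂ 𝔤]
    (Φ : Toroidal.InvariantForm 𝔤) (𝔥 : LieSubalgebra ℂ 𝔤) [𝔥.IsCartanSubalgebra]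
    (V : Type*) [AddCommGroup V] [Module ℂ V]
    [LieRingModule (Toroidal.Tau Φ (N + 1)) V] [LieModule ℂ (Toroidal.Tau Φ (N + 1)) V]
    [LieModule.IsIrreducible ℂ (Toroidal.Tau Φ (N + 1)) V]
    (hV : Toroidal.IsFiniteWeightModule Φ (N + 1) V 𝔥) :
    ((∃ w : Toroidal.Omega (N + 1), ∃ v : V, ⁅Toroidal.Tau.z Φ w, v⁆ ≠ 0) →
      Toroidal.centralRank Φ (N + 1) V = N) ∧
    ∃ B : Matrix.GeneralLinearGroup (Fin (N + 1)) ℤ,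
      (∀ (m : Fin (N + 1) → ℤ) (i : Fin (N + 1)), i ≠ Fin.last N ∨ m (Fin.last N) ≠ 0 →
        ∀ v : V, ⁅Toroidal.tauGL Φ (N + 1) B (Toroidal.Tau.tK Φ m i), v⁆ = 0) ∧
      ∃ (_ : LieRingModule (Toroidal.AffTau Φ N) V) (_ : LieModule ℂ (Toroidal.AffTau Φ N) V),
        ∀ (y : Toroidal.Tau Φ (N + 1)) (v : V),
          ⁅Toroidal.phi Φ N y, v⁆ = ⁅Toroidal.tauGL Φ (N + 1) B y, v⁆ := by
  have : Nontrivial V :=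
    (LieSubmodule.nontrivial_iff ℂ (Toroidal.Tau Φ (N + 1)) V).mp inferInstance
  obtain ⟨X, hX𝔥, hXX⟩ := Φ.exists_form_self_ne_zero 𝔥
  have hX : ∀ Y ∈ 𝔥, ⁅Y, X⁆ = 0 := fun Y hY =>
    congrArg Subtype.val (LieModule.IsTrivial.trivial (⟨Y, hY⟩ : 𝔥) (⟨X, hX𝔥⟩ : 𝔥))
  have adapted := Toroidal.exists_adapted_basis hV hX hXX
  refine ⟨?_, ?_⟩
  · rintro ⟨w, v, hw⟩
    have h0 : ∃ m : Fin (N + 1) → ℤ, Toroidal.centralOp Φ V m ≠ 0 := by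
      by_contra! h
      refine hw ?_
      clear hw
      induction w using Toroidal.omega_induction with
      | hadd w w' hw hw' =>
        rw [← Toroidal.Tau.zHom_apply, map_add, add_lie, Toroidal.Tau.zHom_apply,
          Toroidal.Tau.zHom_apply, hw, hw', add_zero]
      | h m c => exact LinearMap.congr_fun (LinearMap.congr_fun (h m) c) v
    exact Nat.succ_injective (adapted h0).1
  · suffices h : ∃ B : Matrix.GeneralLinearGroup (Fin (N + 1)) ℤ,
        ∀ (m : Fin (N + 1) → ℤ) (i : Fin (N + 1)), i ≠ Fin.last N ∨ m (Fin.last N) ≠ 0 →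
          ∀ v : V, ⁅Toroidal.tauGL Φ (N + 1) B (Toroidal.Tau.tK Φ m i), v⁆ = 0 by
      obtain ⟨B, hB⟩ := h
      exact ⟨B, hB, Toroidal.exists_module_of_central_eq_zero Φ N V
        (Toroidal.tauGL Φ (N + 1) B).toLieHom hB⟩
    by_cases h0 : ∃ m : Fin (N + 1) → ℤ, Toroidal.centralOp Φ V m ≠ 0
    · obtain ⟨-, b, i₀, hb, hb'⟩ := adapted h0
      let σ := Equiv.swap (Fin.last N) i₀
      refine ⟨Toroidal.basisGL (b.reindex σ), fun m i hi v => ?_⟩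
      rw [Toroidal.tauGL_basisGL_tK]
      change Toroidal.centralOpInt Φ V _ (b.reindex σ i) v = 0
      by_contra hne
      have hi' : i = Fin.last N := by
        by_contra hi'
        refine hne ?_
        rw [Module.Basis.reindex_apply, hb' _ _ ?_, LinearMap.zero_apply]
        rw [Equiv.symm_swap]
        intro h
        exact hi' ((Equiv.swap (Fin.last N) i₀).injective
          (h.trans (Equiv.swap_apply_left _ _).symm))
      refine hi.elim (fun h => h hi') fun hm => hm ?_
      rw [← Toroidal.repr_basisGL_mulVec (b.reindex σ) m (Fin.last N),
        Module.Basis.repr_reindex_apply, Equiv.symm_swap, Equiv.swap_apply_left]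
      refine hb _ (Submodule.subset_span (Toroidal.mem_centralDegrees
        (c := fun j => (b.reindex σ i j : ℂ)) fun h => hne ?_))
      exact LinearMap.congr_fun h v
    · push Not at h0
      refine ⟨Toroidal.basisGL (Pi.basisFun ℤ _), fun m i _ v => ?_⟩
      rw [Toroidal.tauGL_basisGL_tK]
      exact LinearMap.congr_fun (LinearMap.congr_fun (h0 _) _) v
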